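/- Let $n\ge 1$ and let $K_n$ be the complete graph with vertices labelled modulo $n$. A \emph{book representation} of $K_n$ with $s$ sheets is an assignment of a sheet number in $\{1,\dots,s\}$ to each edge of $K_n$ (exterior edges included) such that no two edges in the same sheet cross; two edges cross if their endpoints alternate in the cyclic order of the labels. It is realized in $S^3$ as follows. The boundary circle is $C=\{(z,0):|z|=1\}\subset S^3\subset\mathbb{C}^2$. The vertices are $n$ distinct points of $C$, numbered clockwise. Sheet $j$ is a disk with boundary $C$, namely the closure of $\{(z,\sqrt{1-|z|^2}\,e^{i\theta_j(z)}):|z|<1\}$, where the functions $\theta_1<\dots<\theta_s<\theta_1+2\pi$ are continuous on the open unit disk. Each edge is the part of its sheet that projects, under $(z,w)\mapsto z$, onto the chord between its endpoints. (When the $\theta_j$ are constant, a stereographic projection turns $C$ into a line, the sheets into half-planes meeting along that line, and the edges into semicircles.) Theorem. Each of the following moves turns a book representation of $K_n$ with $s$ sheets into a book representation of $K_n$, and every realization of the first is carried to every realization of the second by an ambient isotopy of $S^3$ that takes vertices to vertices and edges to edges according to the relabelling of the vertices given by the move (the identity in 2, 3 and 5). \begin{enumerate} \item Rotating vertices: increase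 or decrease all vertex labels by one, mod $n$. \item Shifting sheets: increase or decrease all sheet numbers by one, mod $s$. \item Edge move: if an edge does not cross any of the edges in an adjacent sheet (sheets $s$ and $1$ also count as adjacent), move the edge into that sheet. \item Vertex exchange: if $v$ and $w$ are consecutive vertices on the boundary circle (their labels differ by one mod $n$), and if the sheet number of each edge incident to $v$ is higher than the sheet number of each edge incident to $w$, the edge $vw$ being disregarded, exchange the positions of $v$ and $w$ and relabel accordingly. \item Sheet insertion/deletion: insert an empty sheet at any place (between two sheets, before the first or after the last), or remove an empty sheet, and renumber the sheets. \item Double reflection: perform one after the other any two (possibly equal) reflections from the following list: the reflections through a diameter of the boundary circle, which replace each vertex label $a$ by $c-a$ mod $n$ for some fixed $c$ and keep the sheet numbers, and the reflection through the plane containing the boundary circle, which keeps the labels and reverses the order of the sheets. \end{enumerate} -/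

import Mathlib

noncomputable section

namespace BookRepresentation

/-- The 3-sphere, as the unit sphere of `ℂ²`. -/
abbrev S3 : Type := Metric.sphere (0 : EuclideanSpace ℂ (Fin 2)) 1

/-- The edges of the complete graph `K_n` on the vertices `0, …, n - 1`. -/
abbrev Edge (n : ℕ) : Type := (⊤ : SimpleGraph (Fin n)).edgeSet

/-- The permutation of the edges of `K_n` that is induced by a permutation of the vertices. -/
def edgePerm {n : ℕ} (σ : Equiv.Perm (Fin n)) : Edge n ≃ Edge n :=
  (SimpleGraph.Iso.completeGraph σ).mapEdgeSet

/-! ### Spatial graphs and ambient isotopy -/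

/-- The image of a drawing of `K_n` in the 3-sphere: the position of each vertex and the point
set of each edge. -/
structure SpatialGraph (n : ℕ) where
  vertex : Fin n → S3
  edge : Edge n → Set S3

/-- There is an ambient isotopy of the 3-sphere, i.e. a continuous family of self-homeomorphisms
that starts at the identity, whose final map carries each vertex `a` of `Γ` to the vertex `σ a` of
`Γ'` and each edge of `Γ` onto the corresponding edge of `Γ'`. -/
def SpatialGraph.AmbientIsotopicVia {n : ℕ} (σ : Equiv.Perm (Fin n))
    (Γ Γ' : SpatialGraph n) : Prop :=
  ∃ H : C(unitInterval × S3, S3),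
    (∀ t, IsHomeomorph fun x => H (t, x)) ∧
    (∀ x, H (0, x) = x) ∧
    (∀ a, H (1, Γ.vertex a) = Γ'.vertex (σ a)) ∧
    ∀ e, (fun x => H (1, x)) '' Γ.edge e = Γ'.edge (edgePerm σ e)

/-! ### Combinatorial description of book representations -/

/-- Two edges cross: their endpoints alternate around the boundary circle, that is, the
corresponding chords intersect in interior points. -/
def Crosses {n : ℕ} (e f : Edge n) : Prop :=
  ∃ a b c d : Fin n, a < b ∧ b < c ∧ c < d ∧
    (((e : Sym2 (Fin n)) = s(a, c) ∧ (f : Sym2 (Fin n)) = s(b, d)) ∨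
      ((e : Sym2 (Fin n)) = s(b, d) ∧ (f : Sym2 (Fin n)) = s(a, c)))

/-- An assignment of one of `s` sheets to each edge of `K_n` describes a book representation if no
two edges in the same sheet cross. -/
def IsBook {n s : ℕ} (A : Edge n → Fin s) : Prop :=
  ∀ e f, A e = A f → ¬ Crosses e f

/-! ### Geometric realization

The boundary circle `C` is the unit circle `{(z, 0) : |z| = 1}` in the plane `ℂ × {0}`, and the
projection to that plane is `(z, w) ↦ z`. A sheet is a disk with boundary `C` consisting of the
points `(z, r exp(iθ(z)))` with `r = √(1 - |z|²)`, for a function `θ` that is continuous on the open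
unit disk. For constant functions `θ` these are the pages of the standard open book: stereographic
projection from a point of `C` turns `C` into a line, the sheets into half-planes that meet along
this line, and the parts of the sheets over chords of `C` into semicircles. -/

/-- A choice of `n` vertices on the boundary circle, numbered in clockwise order, and of `s` sheets
that are disjoint away from the boundary circle and numbered in the order in which they are
stacked. -/
structure Layout (n s : ℕ) where
  /-- Vertex `a` is the point `exp(-i vertexAngle a)` of the boundary circle. -/
  vertexAngle : Fin n → ℝ
  vertexAngle_strictMono : StrictMono vertexAngle
  vertexAngle_lt : ∀ a b, vertexAngle b < vertexAngle a + 2 * Real.pi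
  /-- The angular coordinate of sheet `j` over a point of the open unit disk. -/
  sheetAngle : Fin s → ℂ → ℝ
  continuousOn_sheetAngle : ∀ j, ContinuousOn (sheetAngle j) (Metric.ball 0 1)
  sheetAngle_strictMono : ∀ z ∈ Metric.ball (0 : ℂ) 1, StrictMono fun j => sheetAngle j z
  sheetAngle_lt : ∀ z ∈ Metric.ball (0 : ℂ) 1, ∀ i j,
    sheetAngle j z < sheetAngle i z + 2 * Real.pi

namespace Layout

variable {n s : ℕ}

/-- The position of a vertex in the plane that contains the boundary circle. -/
def position (L : Layout n s) (a : Fin n) : ℂ :=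
  Complex.exp (-(L.vertexAngle a : ℂ) * Complex.I)

/-- The chord of the boundary circle between the endpoints of an edge. -/
def chord (L : Layout n s) (e : Edge n) : Set ℂ :=
  convexHull ℝ (L.position '' {a | a ∈ (e : Sym2 (Fin n))})

/-- Sheet `j`. -/
def sheet (L : Layout n s) (j : Fin s) : Set S3 :=
  {x | x.1 1 = (‖x.1 1‖ : ℂ) * Complex.exp ((L.sheetAngle j (x.1 0) : ℂ) * Complex.I)}

/-- The point of the 3-sphere at which a vertex is placed. -/
def vertexPoint (L : Layout n s) (a : Fin n) : S3 :=
  ⟨!₂[L.position a, 0], by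
    simp [EuclideanSpace.norm_eq, position, Complex.norm_exp]⟩

/-- The book representation of `K_n` given by an assignment of sheets to edges: each edge is the
part of its sheet that projects to its chord. -/
def graph (L : Layout n s) (A : Edge n → Fin s) : SpatialGraph n where
  vertex := L.vertexPoint
  edge e := {x | x ∈ L.sheet (A e) ∧ x.1 0 ∈ L.chord e}

end Layout

/-- All realizations of the first book representation are ambient isotopic in the 3-sphere to all
realizations of the second one, the vertices and edges being matched by `σ`. -/
def IsotopicVia {n s s' : ℕ} (σ : Equiv.Perm (Fin n))
    (A : Edge n → Fin s) (A' : Edge n → Fin s') : Prop :=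
  ∀ (L : Layout n s) (L' : Layout n s'), (L.graph A).AmbientIsotopicVia σ (L'.graph A')

/-! ### The moves -/

/-- Relabel the vertices: the edge between `σ a` and `σ b` gets the sheet of the edge between `a`
and `b`. -/
def relabel {n s : ℕ} (σ : Equiv.Perm (Fin n)) (A : Edge n → Fin s) : Edge n → Fin s :=
  fun e => A ((edgePerm σ).symm e)

/-- Remove the empty sheet `k` and renumber the sheets after it. -/
def deleteSheet {n s : ℕ} (A : Edge n → Fin (s + 1)) (k : Fin (s + 1)) (hk : ∀ e, A e ≠ k) :
    Edge n → Fin s :=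
  fun e => (finSuccAboveEquiv k).symm ⟨A e, hk e⟩

/-- Sheets `i` and `j` are adjacent in the cyclic order of the `s` sheets. -/
def AdjacentSheets {s : ℕ} (i j : Fin s) : Prop :=
  finRotate s i = j ∨ finRotate s j = i

/-- The reflections of a book representation: `diameter c` is the reflection through the diameter
of the boundary circle that sends vertex `a` to vertex `c - a` modulo `n` for all `a`, and `plane`
is the reflection through the plane that contains the boundary circle. -/
inductive Reflection (n : ℕ) where
  | diameter (c : Fin n)
  | plane

namespace Reflection

variable {n : ℕ} [NeZero n]

/-- The effect of a reflection on the vertices. -/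
def vertexPerm : Reflection n → Equiv.Perm (Fin n)
  | diameter c => Equiv.subLeft c
  | plane => 1

/-- The effect of a reflection on a book representation: reflection through a diameter moves the
vertices and keeps the sheets, reflection through the plane keeps the vertices and reverses the
order of the sheets. -/
def apply {s : ℕ} : Reflection n → (Edge n → Fin s) → (Edge n → Fin s)
  | diameter c, A => relabel (Equiv.subLeft c) A
  | plane, A => fun e => (A e).rev

end Reflection

end BookRepresentation

end

/-!
Every book representation is compared with an *arc presentation* of the same graph. The 3-sphere is
the join of the circles `w = 0` and `z = 0`; in an arc presentation the vertices are points of the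
first circle, and each edge consists of the two segments of the join from a point of the second
circle, which is the angle of the edge, to the endpoints of the edge.

A book representation is isotopic to the arc presentation with the same vertices and arbitrary edge
angles, provided that the angles are distinct and put crossing edges in the order of their sheets
(`Layout.graph_ambientIsotopicVia_arc`). First the angular coordinate of the sheets is changed. Over
a point of the open disk only crossing edges meet (`Layout.crosses_of_mem_chord`), so in the circle
over this point a finite set has to be moved without changing its cyclic order. The lifts to the
real line of the homeomorphisms that do so form a convex set, so that local solutions
(`exists_local_circleLift`) can be glued by a partition of unity, and convex combination with the
identity gives an isotopy (`exists_twist`). After that every edge has a page of its own, and a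
homeomorphism of the page, which is a disk, moves the midpoint of the chord to the centre
(`exists_push`).

The arc presentation only depends on the angles of vertices and edges modulo `2π`, and up to isotopy
only on the cyclic order of the vertices (`arc_ambientIsotopicVia`). In this way rotations of the
vertices, shifts of the sheets, edge moves, and insertions and deletions of sheets amount to the
choice of suitable lifts of these angles. The composition of the two kinds of reflections is complex
conjugation of both coordinates, which is isotopic to the identity (`exists_conj`). For the exchange
of two vertices, their edges are put over opposite halves of the second circle; the two vertices
can then be pushed off the first circle into these halves and rotated past each other
(`arc_exchange`).
-/

namespace BookRepresentation

open Set Topology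

/-! ### Coordinates on the 3-sphere -/

namespace S3

lemma norm_sq_add (x : S3) : ‖x.1 0‖ ^ 2 + ‖x.1 1‖ ^ 2 = 1 := by
  have h : ‖x.1‖ = 1 := by simp
  have h2 := EuclideanSpace.norm_sq_eq x.1
  rw [h, Fin.sum_univ_two] at h2
  linarith

lemma ext {x y : S3} (h0 : x.1 0 = y.1 0) (h1 : x.1 1 = y.1 1) : x = y := by
  apply Subtype.ext
  ext i
  fin_cases i
  · exact h0
  · exact h1

/-- The point of the 3-sphere with given coordinates. -/
def mk (z w : ℂ) (h : ‖z‖ ^ 2 + ‖w‖ ^ 2 = 1) : S3 :=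
  ⟨!₂[z, w], by simp [EuclideanSpace.norm_eq, h]⟩

@[simp] lemma mk_zero (z w : ℂ) (h) : (mk z w h).1 0 = z := rfl

@[simp] lemma mk_one (z w : ℂ) (h) : (mk z w h).1 1 = w := rfl

lemma continuous_coord (i : Fin 2) : Continuous fun x : S3 => x.1 i := by
  fun_prop

lemma continuous_mk {X : Type*} [TopologicalSpace X] {z w : X → ℂ}
    (h : ∀ x, ‖z x‖ ^ 2 + ‖w x‖ ^ 2 = 1) (hz : Continuous z) (hw : Continuous w) :
    Continuous fun x => mk (z x) (w x) (h x) := by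
  apply Continuous.subtype_mk
  apply (PiLp.continuous_toLp 2 _).comp
  apply continuous_pi
  intro i
  fin_cases i
  · exact hz
  · exact hw

lemma norm_zero_le (x : S3) : ‖x.1 0‖ ≤ 1 := by
  have := norm_sq_add x
  nlinarith [norm_nonneg (x.1 0), sq_nonneg ‖x.1 1‖]

lemma norm_zero_lt_iff (x : S3) : ‖x.1 0‖ < 1 ↔ x.1 1 ≠ 0 := by
  have := norm_sq_add x
  constructor
  · intro h h1
    rw [h1, norm_zero] at this
    nlinarith [norm_nonneg (x.1 0)]
  · intro h
    have : 0 < ‖x.1 1‖ := norm_pos_iff.2 h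
    nlinarith [norm_nonneg (x.1 0), sq_nonneg ‖x.1 1‖]

lemma norm_zero_eq_one (x : S3) (h : x.1 1 = 0) : ‖x.1 0‖ = 1 := by
  have := norm_sq_add x
  rw [h] at this
  simp at this
  exact this.resolve_right (by linarith [norm_nonneg (x.1 0)])

lemma norm_one_eq (x : S3) : ‖x.1 1‖ = √(1 - ‖x.1 0‖ ^ 2) := by
  rw [← eq_sub_of_add_eq' (norm_sq_add x), Real.sqrt_sq (norm_nonneg _)]

/-- The exchange of the two coordinates. -/
def swap (x : S3) : S3 := mk (x.1 1) (x.1 0) (by rw [add_comm]; exact norm_sq_add x)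

@[simp] lemma swap_zero (x : S3) : (swap x).1 0 = x.1 1 := rfl

@[simp] lemma swap_one (x : S3) : (swap x).1 1 = x.1 0 := rfl

@[simp] lemma swap_swap (x : S3) : swap (swap x) = x := ext rfl rfl

lemma continuous_swap : Continuous swap :=
  continuous_mk _ (continuous_coord 1) (continuous_coord 0)

end S3

/-! ### Homeomorphisms isotopic to the identity -/

/-- `F` is the final map of an ambient isotopy of the 3-sphere. -/
def IsotopicToId (F : S3 → S3) : Prop :=
  ∃ H : C(unitInterval × S3, S3),
    (∀ t, IsHomeomorph fun x => H (t, x)) ∧ (∀ x, H (0, x) = x) ∧ ∀ x, H (1, x) = F x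

namespace IsotopicToId

variable {F G : S3 → S3}

/-- On a compact space it is enough to check that the stages of an isotopy are bijective. -/
lemma of_bijective (H : unitInterval × S3 → S3) (hc : Continuous H)
    (hb : ∀ t, Function.Bijective fun x => H (t, x)) (h0 : ∀ x, H (0, x) = x) :
    IsotopicToId fun x => H (1, x) :=
  ⟨⟨H, hc⟩, fun t => isHomeomorph_iff_continuous_bijective.2
    ⟨hc.comp (Continuous.prodMk_right t), hb t⟩, h0, fun _ => rfl⟩

lemma bijective (h : IsotopicToId F) : Function.Bijective F := by
  obtain ⟨H, hH, -, h1⟩ := h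
  rw [← funext h1]
  exact (hH 1).bijective

lemma comp (hG : IsotopicToId G) (hF : IsotopicToId F) : IsotopicToId (G ∘ F) := by
  obtain ⟨H, hH, h0, h1⟩ := hF
  obtain ⟨K, hK, k0, k1⟩ := hG
  have := of_bijective (fun p => K (p.1, H p)) (by fun_prop)
    (fun t => (hK t).bijective.comp (hH t).bijective) (fun x => by simp [h0, k0])
  simp only [h1, k1] at this
  exact this

/-- The track `(t, x) ↦ (t, H (t, x))` of an isotopy is a continuous bijection of a compact space,
so its inverse is continuous. -/
lemma symm (hF : IsotopicToId F) :
    ∃ G, IsotopicToId G ∧ (∀ x, G (F x) = x) ∧ ∀ x, F (G x) = x := by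
  obtain ⟨H, hH, h0, h1⟩ := hF
  let T : unitInterval × S3 → unitInterval × S3 := fun p => (p.1, H p)
  have hT : IsHomeomorph T := by
    refine isHomeomorph_iff_continuous_bijective.2 ⟨by fun_prop, ?_, ?_⟩
    · rintro ⟨t, x⟩ ⟨t', x'⟩ h
      obtain ⟨rfl, h⟩ := Prod.mk.inj h
      exact congrArg _ ((hH t).injective h)
    · rintro ⟨t, y⟩
      obtain ⟨x, hx⟩ := (hH t).surjective y
      exact ⟨(t, x), Prod.ext rfl hx⟩
  let e := hT.homeomorph
  have he : ∀ p, e p = T p := fun _ => rfl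
  have hfst : ∀ p, (e.symm p).1 = p.1 := fun p => by
    conv_rhs => rw [← e.apply_symm_apply p]
    rfl
  have key : ∀ t y, H (t, (e.symm (t, y)).2) = y := fun t y => by
    have := e.apply_symm_apply (t, y)
    rw [he] at this
    have h2 : (e.symm (t, y)) = (t, (e.symm (t, y)).2) := Prod.ext (hfst _) rfl
    rw [h2] at this
    exact congrArg Prod.snd this
  refine ⟨_, of_bijective (fun p => (e.symm p).2) (by fun_prop) (fun t => ?_) (fun x => ?_), ?_, ?_⟩
  · constructor
    · intro x y h
      rw [← key t x, ← key t y]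
      exact congrArg (fun z => H (t, z)) h
    · intro x
      exact ⟨H (t, x), (hH t).injective (key t _)⟩
  · exact (h0 _).symm.trans (key 0 x)
  · intro x
    exact (hH 1).injective ((key 1 _).trans (h1 x).symm)
  · intro x
    rw [← h1]
    exact key 1 x

lemma conj_swap (hF : IsotopicToId F) : IsotopicToId fun x => S3.swap (F (S3.swap x)) := by
  obtain ⟨H, hH, h0, h1⟩ := hF
  have hs : Function.Bijective S3.swap :=
    Function.Involutive.bijective S3.swap_swap
  have := of_bijective (fun p => S3.swap (H (p.1, S3.swap p.2)))
    (S3.continuous_swap.comp (H.continuous.comp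
      (continuous_fst.prodMk (S3.continuous_swap.comp continuous_snd))))
    (fun t => hs.comp ((hH t).bijective.comp hs)) (fun x => by simp [h0])
  simpa only [h1] using this

end IsotopicToId

lemma mem_edgePerm {n : ℕ} {σ : Equiv.Perm (Fin n)} {e : Edge n} {a : Fin n} :
    σ a ∈ (edgePerm σ e : Sym2 (Fin n)) ↔ a ∈ (e : Sym2 (Fin n)) := by
  change σ a ∈ Sym2.map σ e ↔ _
  rw [Sym2.mem_map]
  simp

lemma coe_edgePerm {n : ℕ} (σ : Equiv.Perm (Fin n)) (e : Edge n) :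
    (edgePerm σ e : Sym2 (Fin n)) = Sym2.map σ e := rfl

lemma edgePerm_mul {n : ℕ} (σ τ : Equiv.Perm (Fin n)) (e : Edge n) :
    edgePerm (σ * τ) e = edgePerm σ (edgePerm τ e) := by
  apply Subtype.ext
  simp only [coe_edgePerm, Sym2.map_map]
  rfl

lemma edgePerm_one {n : ℕ} (e : Edge n) : edgePerm 1 e = e := by
  apply Subtype.ext
  simp [coe_edgePerm]

lemma edgePerm_symm {n : ℕ} (σ : Equiv.Perm (Fin n)) (e : Edge n) :
    (edgePerm σ).symm e = edgePerm σ⁻¹ e := by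
  rw [Equiv.symm_apply_eq, ← edgePerm_mul, mul_inv_cancel, edgePerm_one]

namespace SpatialGraph.AmbientIsotopicVia

variable {n : ℕ} {σ τ : Equiv.Perm (Fin n)} {Γ Γ' Γ'' : SpatialGraph n}

lemma of_isotopicToId {F : S3 → S3} (hF : IsotopicToId F)
    (hv : ∀ a, F (Γ.vertex a) = Γ'.vertex (σ a))
    (he : ∀ e x, F x ∈ Γ'.edge (edgePerm σ e) ↔ x ∈ Γ.edge e) : Γ.AmbientIsotopicVia σ Γ' := by
  have hs := hF.bijective.surjective
  obtain ⟨H, hH, h0, h1⟩ := hF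
  refine ⟨H, hH, h0, fun a => by rw [h1, hv], fun e => ?_⟩
  simp only [h1]
  ext y
  obtain ⟨x, rfl⟩ := hs y
  rw [he]
  constructor
  · rintro ⟨x', hx', h⟩
    rwa [← he, ← h, he]
  · exact fun h => ⟨x, h, rfl⟩

lemma exists_isotopicToId (h : Γ.AmbientIsotopicVia σ Γ') :
    ∃ F, IsotopicToId F ∧ (∀ a, F (Γ.vertex a) = Γ'.vertex (σ a)) ∧
      ∀ e x, F x ∈ Γ'.edge (edgePerm σ e) ↔ x ∈ Γ.edge e := by
  obtain ⟨H, hH, h0, hv, he⟩ := h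
  refine ⟨_, ⟨H, hH, h0, fun _ => rfl⟩, hv, fun e x => ?_⟩
  rw [← he e]
  exact (hH 1).injective.mem_set_image

lemma trans (h : Γ.AmbientIsotopicVia σ Γ') (h' : Γ'.AmbientIsotopicVia τ Γ'') :
    Γ.AmbientIsotopicVia (τ * σ) Γ'' := by
  obtain ⟨F, hF, hv, he⟩ := h.exists_isotopicToId
  obtain ⟨F', hF', hv', he'⟩ := h'.exists_isotopicToId
  refine of_isotopicToId (hF'.comp hF) (fun a => ?_) fun e x => ?_
  · simp [hv, hv']
  · rw [edgePerm_mul, Function.comp_apply, he', he]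

lemma symm (h : Γ.AmbientIsotopicVia σ Γ') : Γ'.AmbientIsotopicVia σ⁻¹ Γ := by
  obtain ⟨F, hF, hv, he⟩ := h.exists_isotopicToId
  obtain ⟨G, hG, hGF, hFG⟩ := hF.symm
  refine of_isotopicToId hG (fun a => ?_) fun e x => ?_
  · rw [← hGF (Γ.vertex _), hv]
    simp
  · rw [← he, hFG, ← edgePerm_mul, mul_inv_cancel, edgePerm_one]

end SpatialGraph.AmbientIsotopicVia

/-! ### Angles and lifts of circle homeomorphisms -/

/-- The point of the unit circle with angular coordinate `φ`. -/
noncomputable def cis (φ : ℝ) : ℂ := Complex.exp (φ * Complex.I)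

@[simp] lemma norm_cis (φ : ℝ) : ‖cis φ‖ = 1 := Complex.norm_exp_ofReal_mul_I φ

@[fun_prop] lemma continuous_cis : Continuous cis := by
  unfold cis
  fun_prop

lemma cis_add (φ ψ : ℝ) : cis (φ + ψ) = cis φ * cis ψ := by
  simp [cis, add_mul, Complex.exp_add]

lemma cis_eq_cis_iff {φ ψ : ℝ} : cis φ = cis ψ ↔ ∃ k : ℤ, φ = ψ + 2 * Real.pi * k := by
  rw [cis, cis, Complex.exp_eq_exp_iff_exists_int]
  refine exists_congr fun k => ?_
  have : (ψ : ℂ) * Complex.I + k * (2 * Real.pi * Complex.I)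
      = ((ψ + 2 * Real.pi * k : ℝ) : ℂ) * Complex.I := by push_cast; ring
  rw [this, mul_left_inj' Complex.I_ne_zero, Complex.ofReal_inj]

lemma eq_of_cis_eq {φ ψ : ℝ} (h : cis φ = cis ψ) (h1 : φ < ψ + 2 * Real.pi)
    (h2 : ψ < φ + 2 * Real.pi) : φ = ψ := by
  obtain ⟨k, hk⟩ := cis_eq_cis_iff.1 h
  have hpi := Real.two_pi_pos
  have h3 : (k : ℝ) < 1 := by nlinarith
  have h4 : (-1 : ℝ) < k := by nlinarith
  have h5 : k = 0 := by
    have : k < 1 := by exact_mod_cast h3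
    have : -1 < k := by exact_mod_cast h4
    omega
  simpa [h5] using hk

lemma cis_add_int_mul (φ : ℝ) (k : ℤ) : cis (φ + 2 * Real.pi * k) = cis φ :=
  cis_eq_cis_iff.2 ⟨k, rfl⟩

lemma norm_mul_cis_arg (w : ℂ) : (‖w‖ : ℂ) * cis w.arg = w := Complex.norm_mul_exp_arg_mul_I w

/-- `f` is the lift to the real line of an orientation preserving homeomorphism of the circle. -/
structure IsCircleLift (f : ℝ → ℝ) : Prop where
  strictMono : StrictMono f
  continuous : Continuous f
  map_add : ∀ φ, f (φ + 2 * Real.pi) = f φ + 2 * Real.pi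

namespace IsCircleLift

variable {f g : ℝ → ℝ}

protected lemma id : IsCircleLift fun φ => φ := ⟨strictMono_id, continuous_id, fun _ => rfl⟩

lemma map_add_int (hf : IsCircleLift f) (φ : ℝ) (k : ℤ) :
    f (φ + 2 * Real.pi * k) = f φ + 2 * Real.pi * k := by
  have hper : Function.Periodic (fun φ => f φ - φ) (2 * Real.pi) := fun φ => by
    simp only [hf.map_add]
    ring
  have := hper.int_mul k φ
  rw [mul_comm (2 * Real.pi)]
  linarith

lemma surjective (hf : IsCircleLift f) : Function.Surjective f := by
  intro y
  have hpi := Real.two_pi_pos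
  set k : ℤ := ⌊(y - f 0) / (2 * Real.pi)⌋ with hk
  have h1 := Int.floor_le ((y - f 0) / (2 * Real.pi))
  have h2 := Int.lt_floor_add_one ((y - f 0) / (2 * Real.pi))
  rw [← hk] at h1 h2
  rw [le_div_iff₀ hpi] at h1
  rw [div_lt_iff₀ hpi] at h2
  have e1 := hf.map_add_int 0 k
  have e2 := hf.map_add_int 0 (k + 1)
  push_cast at e2
  have := intermediate_value_Icc (a := 0 + 2 * Real.pi * k) (b := 0 + 2 * Real.pi * (k + 1))
    (by linarith) hf.continuous.continuousOn
  rw [e1, e2] at this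
  obtain ⟨x, -, hx⟩ := this (show y ∈ Icc _ _ by constructor <;> linarith)
  exact ⟨x, hx⟩

lemma cis_apply_eq_iff (hf : IsCircleLift f) {φ ψ : ℝ} : cis (f φ) = cis (f ψ) ↔ cis φ = cis ψ := by
  rw [cis_eq_cis_iff, cis_eq_cis_iff]
  refine exists_congr fun k => ?_
  rw [← hf.map_add_int, hf.strictMono.injective.eq_iff]

lemma convexComb (hf : IsCircleLift f) (hg : IsCircleLift g) {a b : ℝ} (ha : 0 ≤ a) (hb : 0 ≤ b)
    (hab : a + b = 1) : IsCircleLift fun φ => a * f φ + b * g φ where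
  strictMono φ ψ h := by
    have h1 := hf.strictMono h
    have h2 := hg.strictMono h
    rcases ha.eq_or_lt with rfl | ha
    · simp only [zero_add] at hab
      simpa [hab] using h2
    · nlinarith
  continuous := by
    have := hf.continuous
    have := hg.continuous
    fun_prop
  map_add φ := by
    rw [hf.map_add, hg.map_add]
    linear_combination 2 * Real.pi * hab

end IsCircleLift

/-! ### Elementary isotopies -/

lemma continuous_mul_of_norm_le_one {X : Type*} [TopologicalSpace X] {a b : X → ℂ}
    (ha : Continuous a) (hb : ContinuousOn b {x | a x ≠ 0}) (hle : ∀ x, ‖b x‖ ≤ 1) :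
    Continuous fun x => a x * b x := by
  rw [continuous_iff_continuousAt]
  intro x
  by_cases hx : a x = 0
  · rw [ContinuousAt, hx, zero_mul, tendsto_zero_iff_norm_tendsto_zero]
    have h0 : Filter.Tendsto (fun y => ‖a y‖) (𝓝 x) (𝓝 0) := by
      simpa [hx] using (ha.norm.tendsto x)
    refine squeeze_zero (fun _ => norm_nonneg _) (fun y => ?_) h0
    rw [norm_mul]
    exact mul_le_of_le_one_right (norm_nonneg _) (hle y)
  · exact ha.continuousAt.mul
      (hb.continuousAt ((isOpen_ne_fun ha continuous_const).mem_nhds hx))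

lemma eq_norm_mul_cis_iff {w : ℂ} (hw : w ≠ 0) {φ : ℝ} :
    w = ‖w‖ * cis φ ↔ cis w.arg = cis φ := by
  conv_lhs => rw [← norm_mul_cis_arg w]
  simp only [norm_mul, Complex.norm_real, norm_norm, norm_cis, mul_one]
  rw [mul_right_inj']
  simpa using hw

/-- Rotating the second coordinate by an amount which is an increasing function of its angle, the
function depending on the first coordinate, is isotopic to the identity: interpolate linearly
between the lifts and the identity. No condition is needed on the boundary of the disk, since the
second coordinate tends to zero there. -/
theorem exists_twist (g : ℂ → ℝ → ℝ)
    (hc : ContinuousOn (fun p : ℂ × ℝ => g p.1 p.2) (Metric.ball 0 1 ×ˢ univ))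
    (hg : ∀ z ∈ Metric.ball (0 : ℂ) 1, IsCircleLift (g z)) :
    ∃ F, IsotopicToId F ∧ (∀ x, (F x).1 0 = x.1 0) ∧
      ∀ (x : S3) (φ : ℝ), (F x).1 1 = ‖(F x).1 1‖ * cis (g (x.1 0) φ) ↔
        x.1 1 = ‖x.1 1‖ * cis φ := by
  let D : S3 → ℝ := fun x => g (x.1 0) (x.1 1).arg - (x.1 1).arg
  have hball : ∀ x : S3, x.1 1 ≠ 0 → x.1 0 ∈ Metric.ball (0 : ℂ) 1 := fun x hx => by
    simpa using (S3.norm_zero_lt_iff x).2 hx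
  -- the displacement does not depend on the choice of the argument
  have hD : ∀ x : S3, x.1 1 ≠ 0 → ∀ φ, cis (x.1 1).arg = cis φ → D x = g (x.1 0) φ - φ := by
    intro x hx φ h
    obtain ⟨k, hk⟩ := cis_eq_cis_iff.1 h
    simp only [D]
    rw [hk, (hg _ (hball x hx)).map_add_int]
    ring
  have hDc : ∀ x : S3, x.1 1 ≠ 0 → ContinuousAt D x := by
    intro x hx
    have hU : ∀ᶠ y : S3 in 𝓝 x, y.1 1 ≠ 0 :=
      (isOpen_ne_fun (S3.continuous_coord 1) continuous_const).mem_nhds hx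
    let B : S3 → ℝ := fun y => (x.1 1).arg + (y.1 1 / x.1 1).arg
    have hB : ContinuousAt B x := by
      have h1 : ContinuousAt (fun y : S3 => y.1 1 / x.1 1) x :=
        ((S3.continuous_coord 1).div_const _).continuousAt
      have h2 : ContinuousAt Complex.arg (x.1 1 / x.1 1) :=
        Complex.continuousAt_arg (by rw [div_self hx]; exact Complex.one_mem_slitPlane)
      exact continuousAt_const.add (ContinuousAt.comp (f := fun y : S3 => y.1 1 / x.1 1) h2 h1)
    have hpair : ContinuousAt (fun y : S3 => g (y.1 0) (B y)) x := by
      have h3 : ContinuousAt (fun p : ℂ × ℝ => g p.1 p.2) (x.1 0, B x) :=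
        hc.continuousAt (prod_mem_nhds (Metric.isOpen_ball.mem_nhds (hball x hx)) Filter.univ_mem)
      exact ContinuousAt.comp (f := fun y : S3 => (y.1 0, B y)) h3
        ((S3.continuous_coord 0).continuousAt.prodMk hB)
    refine (hpair.sub hB).congr ?_
    filter_upwards [hU] with y hy
    refine (hD y hy (B y) ?_).symm
    rw [← eq_norm_mul_cis_iff hy, cis_add]
    have e1 := norm_mul_cis_arg (x.1 1)
    have e2 := norm_mul_cis_arg (y.1 1 / x.1 1)
    have hx' : (‖x.1 1‖ : ℂ) ≠ 0 := by simpa using hx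
    rw [norm_div, Complex.ofReal_div, div_mul_eq_mul_div, div_eq_iff hx'] at e2
    calc y.1 1 = y.1 1 / x.1 1 * x.1 1 := by field_simp
      _ = y.1 1 / x.1 1 * (‖x.1 1‖ * cis (x.1 1).arg) := by rw [e1]
      _ = (y.1 1 / x.1 1 * ‖x.1 1‖) * cis (x.1 1).arg := by ring
      _ = _ := by rw [← e2]; ring
  let H : unitInterval × S3 → S3 := fun p =>
    S3.mk (p.2.1 0) (p.2.1 1 * cis (p.1 * D p.2)) (by simpa using S3.norm_sq_add p.2)
  have hH0 : ∀ p, (H p).1 0 = p.2.1 0 := fun _ => rfl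
  have hH1 : ∀ p, (H p).1 1 = p.2.1 1 * cis (p.1 * D p.2) := fun _ => rfl
  have hHn : ∀ p, ‖(H p).1 1‖ = ‖p.2.1 1‖ := fun p => by simp [hH1]
  have hHc : Continuous H := by
    refine S3.continuous_mk _ ((S3.continuous_coord 0).comp continuous_snd)
      (continuous_mul_of_norm_le_one ((S3.continuous_coord 1).comp continuous_snd) ?_
        fun p => (norm_cis _).le)
    intro p hp
    refine (continuous_cis.continuousAt.comp (ContinuousAt.mul ?_ ?_)).continuousWithinAt
    · exact (continuous_subtype_val.comp continuous_fst).continuousAt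
    · exact ContinuousAt.comp (f := Prod.snd) (hDc p.2 hp) continuousAt_snd
  have hlift : ∀ (t : unitInterval), ∀ z ∈ Metric.ball (0 : ℂ) 1,
      IsCircleLift fun φ => (1 - t : ℝ) * φ + t * g z φ := fun t z hz =>
    IsCircleLift.id.convexComb (hg z hz) (by linarith [t.2.2]) t.2.1 (by ring)
  have key : ∀ (t : unitInterval) (x : S3), x.1 1 ≠ 0 →
      (H (t, x)).1 1 = ‖x.1 1‖ * cis ((1 - t : ℝ) * (x.1 1).arg + t * g (x.1 0) (x.1 1).arg) := by
    intro t x hx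
    rw [hH1]
    conv_lhs => rw [← norm_mul_cis_arg (x.1 1)]
    rw [mul_assoc, ← cis_add]
    congr 2
    simp only [D]
    ring
  refine ⟨_, IsotopicToId.of_bijective H hHc (fun t => ⟨?_, ?_⟩) ?_, fun _ => rfl, ?_⟩
  · intro x y h
    simp only at h
    have h0 : x.1 0 = y.1 0 := by rw [← hH0 (t, x), h, hH0]
    have hn : ‖x.1 1‖ = ‖y.1 1‖ := by rw [← hHn (t, x), h, hHn]
    refine S3.ext h0 ?_
    by_cases hx : x.1 1 = 0
    · rw [hx]
      exact (norm_eq_zero.1 (by rw [← hn, hx, norm_zero])).symm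
    have hy : y.1 1 ≠ 0 := by rwa [← norm_ne_zero_iff, ← hn, norm_ne_zero_iff]
    have h1 := key t x hx
    rw [h, key t y hy, hn, h0, mul_right_inj' (by simpa using hy),
      (hlift t _ (hball y hy)).cis_apply_eq_iff] at h1
    rw [← norm_mul_cis_arg (x.1 1), ← norm_mul_cis_arg (y.1 1), hn, h1]
  · intro y
    by_cases hy : y.1 1 = 0
    · exact ⟨y, S3.ext rfl (by simp [hH1, hy])⟩
    obtain ⟨φ, hφ⟩ := (hlift t _ (hball y hy)).surjective (y.1 1).arg
    let x := S3.mk (y.1 0) (‖y.1 1‖ * cis φ) (by simpa using S3.norm_sq_add y)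
    have hx1 : x.1 1 = ‖y.1 1‖ * cis φ := rfl
    have hxn : ‖x.1 1‖ = ‖y.1 1‖ := by simp [hx1]
    have hx : x.1 1 ≠ 0 := by rwa [← norm_ne_zero_iff, hxn, norm_ne_zero_iff]
    refine ⟨x, S3.ext rfl ?_⟩
    simp only
    rw [key t x hx, hxn]
    conv_rhs => rw [← norm_mul_cis_arg (y.1 1), ← hφ]
    congr 1
    refine (hlift t _ (hball y hy)).cis_apply_eq_iff.2 ((eq_norm_mul_cis_iff hx).1 ?_)
    rw [hxn, hx1]
  · intro x
    exact S3.ext rfl (by simp [hH1, cis])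
  · intro x φ
    simp only
    rw [hHn]
    by_cases hx : x.1 1 = 0
    · simp [hH1, hx]
    rw [key 1 x hx, eq_norm_mul_cis_iff hx, mul_right_inj' (by simpa using hx)]
    simpa using (hg _ (hball x hx)).cis_apply_eq_iff

/-- The cone over the identity of the unit circle that moves the centre of the disk to `a`: it maps
the radius from `0` to a boundary point `p` linearly onto the segment from `a` to `p`. -/
noncomputable def coneMap (a z : ℂ) : ℂ := z + (1 - ‖z‖ : ℝ) * a

section coneMap

variable {a z : ℂ}

lemma coneMap_of_norm_eq_one (hz : ‖z‖ = 1) : coneMap a z = z := by simp [coneMap, hz]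

lemma norm_coneMap_le (hz : ‖z‖ ≤ 1) : ‖coneMap a z‖ ≤ ‖z‖ + (1 - ‖z‖) * ‖a‖ := by
  refine (norm_add_le _ _).trans ?_
  rw [norm_mul, Complex.norm_real, Real.norm_of_nonneg (by linarith)]

lemma norm_coneMap_lt_one (ha : ‖a‖ < 1) (hz : ‖z‖ < 1) : ‖coneMap a z‖ < 1 :=
  (norm_coneMap_le hz.le).trans_lt (by nlinarith [norm_nonneg z])

lemma norm_coneMap_le_one (ha : ‖a‖ < 1) (hz : ‖z‖ ≤ 1) : ‖coneMap a z‖ ≤ 1 :=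
  (norm_coneMap_le hz).trans (by nlinarith [norm_nonneg z])

lemma norm_coneMap_lt_one_iff (ha : ‖a‖ < 1) (hz : ‖z‖ ≤ 1) : ‖coneMap a z‖ < 1 ↔ ‖z‖ < 1 := by
  refine ⟨fun h => ?_, norm_coneMap_lt_one ha⟩
  rcases hz.lt_or_eq with hz | hz
  · exact hz
  · rwa [coneMap_of_norm_eq_one hz] at h

lemma coneMap_injective (ha : ‖a‖ < 1) : Function.Injective (coneMap a) := by
  intro z w h
  simp only [coneMap] at h
  have h1 : z - w = ((‖z‖ - ‖w‖ : ℝ) : ℂ) * a := by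
    push_cast at h ⊢
    linear_combination h
  have h2 : ‖z - w‖ ≤ ‖z - w‖ * ‖a‖ := by
    conv_lhs => rw [h1]
    rw [norm_mul, Complex.norm_real]
    exact mul_le_mul_of_nonneg_right (abs_norm_sub_norm_le z w) (norm_nonneg a)
  have h3 : ‖z - w‖ = 0 := by nlinarith [norm_nonneg (z - w)]
  exact sub_eq_zero.1 (norm_eq_zero.1 h3)

/-- The preimage of `y` is the fixed point of the contraction `z ↦ y - (1 - ‖z‖) a`. -/
lemma exists_coneMap_eq (ha : ‖a‖ < 1) {y : ℂ} (hy : ‖y‖ < 1) : ∃ z, ‖z‖ < 1 ∧ coneMap a z = y := by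
  have hK : ContractingWith ‖a‖₊ fun z : ℂ => y - (1 - ‖z‖ : ℝ) * a := by
    refine ⟨ha, LipschitzWith.of_dist_le_mul fun z w => ?_⟩
    have : y - ((1 - ‖z‖ : ℝ) : ℂ) * a - (y - ((1 - ‖w‖ : ℝ) : ℂ) * a)
        = ((‖z‖ - ‖w‖ : ℝ) : ℂ) * a := by push_cast; ring
    rw [dist_eq_norm, this, norm_mul, Complex.norm_real, mul_comm, dist_eq_norm]
    exact mul_le_mul_of_nonneg_left (abs_norm_sub_norm_le z w) (norm_nonneg a)
  obtain ⟨z, hz⟩ : ∃ z, y - ((1 - ‖z‖ : ℝ) : ℂ) * a = z := ⟨_, hK.fixedPoint_isFixedPt⟩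
  refine ⟨z, ?_, by rw [coneMap]; linear_combination -hz⟩
  by_contra! h
  have h1 : ‖z‖ ≤ ‖y‖ + (‖z‖ - 1) * ‖a‖ := by
    conv_lhs => rw [← hz]
    refine (norm_sub_le _ _).trans ?_
    rw [norm_mul, Complex.norm_real, Real.norm_of_nonpos (by linarith)]
    linarith
  nlinarith [norm_nonneg a]

lemma coneMap_mem_segment_iff (ha : ‖a‖ < 1) {p : ℂ} (hp : ‖p‖ = 1) :
    coneMap a z ∈ segment ℝ a p ↔ ‖z‖ ≤ 1 ∧ z = ‖z‖ * p := by
  constructor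
  · rintro ⟨α, β, hα, hβ, hαβ, h⟩
    have hn : ‖(β : ℂ) * p‖ = β := by simp [hp, abs_of_nonneg hβ]
    have : z = β * p := by
      apply coneMap_injective ha
      rw [← h, coneMap, hn, ← hαβ]
      simp [add_comm]
    rw [this, hn]
    exact ⟨by linarith, rfl⟩
  · rintro ⟨h1, h⟩
    refine ⟨1 - ‖z‖, ‖z‖, by linarith, norm_nonneg z, by ring, ?_⟩
    rw [coneMap, Complex.real_smul, Complex.real_smul, ← h, add_comm]

end coneMap

lemma eq_norm_mul_div (w : ℂ) : w = ‖w‖ * (w / ‖w‖) := by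
  by_cases hw : w = 0
  · simp [hw]
  · have : (‖w‖ : ℂ) ≠ 0 := by simpa using hw
    field_simp

/-- In the page of angle `u`, the map `coneMap (m u)` moves the centre of the page to the point over
`m u` and fixes the boundary. Together these maps are isotopic to the identity, by shrinking `m`. -/
theorem exists_push (m : C(ℂ, ℂ)) (hm : ∀ u, ‖m u‖ < 1) :
    ∃ F, IsotopicToId F ∧
      (∀ (x : S3) (u : ℂ), ‖u‖ = 1 → ((F x).1 1 = ‖(F x).1 1‖ * u ↔ x.1 1 = ‖x.1 1‖ * u)) ∧
      ∀ (x : S3) (u : ℂ), ‖u‖ = 1 → x.1 1 = ‖x.1 1‖ * u → (F x).1 0 = coneMap (m u) (x.1 0) := by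
  let u : S3 → ℂ := fun x => x.1 1 / ‖x.1 1‖
  let z : unitInterval × S3 → ℂ := fun p => coneMap (p.1 * m (u p.2)) (p.2.1 0)
  have hm' : ∀ (t : unitInterval) v, ‖(t : ℂ) * m v‖ < 1 := fun t v => by
    rw [norm_mul, Complex.norm_real, Real.norm_of_nonneg t.2.1]
    nlinarith [hm v, norm_nonneg (m v), t.2.1, t.2.2]
  have hu : ∀ x : S3, x.1 1 ≠ 0 → ‖u x‖ = 1 := fun x hx => by
    simp [u, hx]
  have huc : ContinuousOn u {x | x.1 1 ≠ 0} := by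
    refine ContinuousOn.div (S3.continuous_coord 1).continuousOn
      (Complex.continuous_ofReal.comp (S3.continuous_coord 1).norm).continuousOn fun x hx => ?_
    simpa using hx
  have hz1 : ∀ p, ‖z p‖ ≤ 1 := fun p => norm_coneMap_le_one (hm' _ _) (S3.norm_zero_le _)
  have hzlt : ∀ p, ‖z p‖ < 1 ↔ p.2.1 1 ≠ 0 := fun p => by
    rw [norm_coneMap_lt_one_iff (hm' _ _) (S3.norm_zero_le _), S3.norm_zero_lt_iff]
  have hu2 : ContinuousOn (fun p : unitInterval × S3 => u p.2) {p | p.2.1 1 ≠ 0} :=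
    huc.comp continuousOn_snd fun _ h => h
  have hzc : Continuous z := by
    refine ((S3.continuous_coord 0).comp continuous_snd).add
      (continuous_mul_of_norm_le_one ?_ ?_ fun p => (hm' _ _).le)
    · have := (S3.continuous_coord 0).comp (continuous_snd (X := unitInterval))
      exact Complex.continuous_ofReal.comp (continuous_const.sub this.norm)
    · have hsub : {p : unitInterval × S3 | ((1 - ‖p.2.1 0‖ : ℝ) : ℂ) ≠ 0} ⊆ {p | p.2.1 1 ≠ 0} := by
        intro p hp h
        exact hp (by rw [S3.norm_zero_eq_one _ h]; simp)
      exact (Complex.continuous_ofReal.comp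
        (continuous_subtype_val.comp continuous_fst)).continuousOn.mul
          (m.continuous.comp_continuousOn (hu2.mono hsub))
  let r : unitInterval × S3 → ℝ := fun p => √(1 - ‖z p‖ ^ 2)
  have hr : ∀ p, r p ^ 2 = 1 - ‖z p‖ ^ 2 := fun p =>
    Real.sq_sqrt (by nlinarith [hz1 p, norm_nonneg (z p)])
  have hr0 : ∀ p, r p ≠ 0 ↔ p.2.1 1 ≠ 0 := fun p => by
    rw [← hzlt, ← pow_ne_zero_iff two_ne_zero, hr]
    have h1 := hz1 p
    have h0 := norm_nonneg (z p)
    constructor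
    · intro h
      refine h1.lt_of_ne fun h' => h (by rw [h']; norm_num)
    · intro h
      nlinarith
  let H : unitInterval × S3 → S3 := fun p => S3.mk (z p) (r p * u p.2) (by
    by_cases h : p.2.1 1 = 0
    · have h0 : r p = 0 := not_not.1 (mt (hr0 p).1 (not_not.2 h))
      have := hr p
      rw [h0] at this ⊢
      rw [Complex.ofReal_zero, zero_mul, norm_zero]
      linarith
    · rw [norm_mul, hu _ h, Complex.norm_real, mul_one, Real.norm_eq_abs, sq_abs, hr]
      ring)
  have hHc : Continuous H := by
    refine S3.continuous_mk _ hzc (continuous_mul_of_norm_le_one ?_ ?_ fun p => ?_)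
    · exact Complex.continuous_ofReal.comp
        (Real.continuous_sqrt.comp (continuous_const.sub (hzc.norm.pow 2)))
    · exact hu2.mono fun p hp => (hr0 p).1 (by simpa using hp)
    · by_cases h : p.2.1 1 = 0
      · simp [u, h]
      · exact (hu _ h).le
  have hH1 : ∀ p, ‖(H p).1 1‖ = r p := fun p => by
    change ‖(r p : ℂ) * u p.2‖ = r p
    by_cases h : p.2.1 1 = 0
    · have h0 : r p = 0 := not_not.1 (mt (hr0 p).1 (not_not.2 h))
      simp [h0]
    · rw [norm_mul, hu _ h, mul_one, Complex.norm_real, Real.norm_of_nonneg (Real.sqrt_nonneg _)]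
  have hHu : ∀ p, u (H p) = u p.2 := fun p => by
    change (H p).1 1 / ‖(H p).1 1‖ = u p.2
    rw [hH1]
    change (r p : ℂ) * u p.2 / r p = u p.2
    by_cases h : p.2.1 1 = 0
    · simp [u, h]
    · have : (r p : ℂ) ≠ 0 := by simpa using (hr0 p).2 h
      field_simp
  have hx1 : ∀ x : S3, x.1 1 = √(1 - ‖x.1 0‖ ^ 2) * u x := fun x => by
    rw [← S3.norm_one_eq]
    exact eq_norm_mul_div _
  have hdir : ∀ (x : S3) (v : ℂ), ‖v‖ = 1 → x.1 1 ≠ 0 → (x.1 1 = ‖x.1 1‖ * v ↔ u x = v) := by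
    intro x v hv hx
    have : (‖x.1 1‖ : ℂ) ≠ 0 := by simpa using hx
    simp only [u]
    rw [div_eq_iff this, mul_comm]
  have hne : ∀ p, (H p).1 1 ≠ 0 ↔ p.2.1 1 ≠ 0 := fun p => by
    rw [← norm_ne_zero_iff, hH1, hr0]
  refine ⟨_, IsotopicToId.of_bijective H hHc (fun t => ⟨?_, ?_⟩) ?_, ?_, ?_⟩
  · intro x y h
    simp only at h
    have hu' : u x = u y := by rw [← hHu (t, x), h, hHu]
    have hz : coneMap (t * m (u x)) (x.1 0) = coneMap (t * m (u y)) (y.1 0) :=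
      congrArg (fun q : S3 => q.1 0) h
    rw [hu'] at hz
    have h0 := coneMap_injective (hm' t _) hz
    exact S3.ext h0 (by rw [hx1 x, hx1 y, h0, hu'])
  · intro y
    by_cases hy : y.1 1 = 0
    · refine ⟨y, S3.ext (coneMap_of_norm_eq_one (S3.norm_zero_eq_one _ hy)) ?_⟩
      rw [hy]
      exact not_not.1 (mt (hne (t, y)).1 (not_not.2 hy))
    obtain ⟨v, hv, hvy⟩ := exists_coneMap_eq (hm' t (u y)) ((S3.norm_zero_lt_iff y).2 hy)
    have hv2 : 0 < 1 - ‖v‖ ^ 2 := by nlinarith [norm_nonneg v]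
    have hs := Real.sqrt_pos.2 hv2
    have hn : ‖(√(1 - ‖v‖ ^ 2) : ℂ) * u y‖ = √(1 - ‖v‖ ^ 2) := by
      rw [norm_mul, hu y hy, mul_one, Complex.norm_real, Real.norm_of_nonneg hs.le]
    let x := S3.mk v (√(1 - ‖v‖ ^ 2) * u y) (by rw [hn, Real.sq_sqrt hv2.le]; ring)
    have hux : u x = u y := by
      change (√(1 - ‖v‖ ^ 2) : ℂ) * u y / ‖(√(1 - ‖v‖ ^ 2) : ℂ) * u y‖ = u y
      rw [hn]
      have : ((√(1 - ‖v‖ ^ 2) : ℝ) : ℂ) ≠ 0 := by exact_mod_cast hs.ne'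
      field_simp
    have hzx : z (t, x) = y.1 0 := by
      change coneMap (t * m (u x)) v = _
      rw [hux, hvy]
    refine ⟨x, S3.ext hzx ?_⟩
    change ((√(1 - ‖z (t, x)‖ ^ 2) : ℝ) : ℂ) * u x = _
    rw [hzx, hux, ← hx1]
  · intro x
    have hz0 : z (0, x) = x.1 0 := by simp [z, coneMap]
    refine S3.ext hz0 ?_
    change ((√(1 - ‖z (0, x)‖ ^ 2) : ℝ) : ℂ) * u x = _
    rw [hz0, ← hx1]
  · intro x v hv
    by_cases hx : x.1 1 = 0
    · have : (H (1, x)).1 1 = 0 := not_not.1 (mt (hne (1, x)).1 (not_not.2 hx))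
      simp [hx, this]
    · rw [hdir _ v hv hx, hdir _ v hv ((hne (1, x)).2 hx), hHu]
  · intro x v hv hxv
    by_cases hx : x.1 1 = 0
    · have h1 := S3.norm_zero_eq_one _ hx
      change coneMap _ _ = _
      rw [coneMap_of_norm_eq_one h1, coneMap_of_norm_eq_one h1]
    · change coneMap (((1 : unitInterval) : ℝ) * m (u x)) _ = _
      rw [(hdir x v hv hx).1 hxv]
      simp

/-- Complex conjugation of both coordinates is the half turn in the plane spanned by the two
imaginary axes. -/
theorem exists_conj : ∃ F, IsotopicToId F ∧
    (∀ x, (F x).1 0 = (starRingEnd ℂ) (x.1 0)) ∧ ∀ x, (F x).1 1 = (starRingEnd ℂ) (x.1 1) := by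
  have hnorm : ∀ (θ : ℝ) (z w : ℂ), ‖z‖ ^ 2 + ‖w‖ ^ 2 = 1 →
      ‖(⟨z.re, Real.cos θ * z.im - Real.sin θ * w.im⟩ : ℂ)‖ ^ 2 +
        ‖(⟨w.re, Real.sin θ * z.im + Real.cos θ * w.im⟩ : ℂ)‖ ^ 2 = 1 := by
    intro θ z w h
    simp only [← Complex.normSq_eq_norm_sq, Complex.normSq_apply] at h ⊢
    linear_combination h + (z.im ^ 2 + w.im ^ 2) * Real.sin_sq_add_cos_sq θ
  obtain ⟨R, hRc, hR0, hR1⟩ : ∃ R : ℝ → S3 → S3, (Continuous fun p : ℝ × S3 => R p.1 p.2) ∧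
      (∀ θ x, (R θ x).1 0 =
        ⟨(x.1 0).re, Real.cos θ * (x.1 0).im - Real.sin θ * (x.1 1).im⟩) ∧
      ∀ θ x, (R θ x).1 1 =
        ⟨(x.1 1).re, Real.sin θ * (x.1 0).im + Real.cos θ * (x.1 1).im⟩ := by
    refine ⟨fun θ x => S3.mk _ _ (hnorm θ _ _ (S3.norm_sq_add x)), ?_, fun _ _ => rfl,
      fun _ _ => rfl⟩
    have hc : ∀ i, Continuous fun p : ℝ × S3 => p.2.1 i := fun i =>
      (S3.continuous_coord i).comp continuous_snd
    have h0 := hc 0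
    have h1 := hc 1
    refine S3.continuous_mk _ ?_ ?_ <;> simp only [Complex.mk_eq_add_mul_I] <;> fun_prop
  have hR : ∀ θ x, R (-θ) (R θ x) = x := fun θ x => by
    refine S3.ext ?_ ?_
    · rw [hR0, hR0, hR1]
      apply Complex.ext
      · rfl
      · simp only [Real.cos_neg, Real.sin_neg]
        linear_combination (x.1 0).im * Real.sin_sq_add_cos_sq θ
    · rw [hR1, hR0, hR1]
      apply Complex.ext
      · rfl
      · simp only [Real.cos_neg, Real.sin_neg]
        linear_combination (x.1 1).im * Real.sin_sq_add_cos_sq θ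
  refine ⟨_, IsotopicToId.of_bijective (fun p => R (Real.pi * p.1) p.2)
    (hRc.comp (f := fun p : unitInterval × S3 => (Real.pi * p.1, p.2)) (by fun_prop))
    (fun t => ?_) (fun x => S3.ext ?_ ?_), fun x => ?_, fun x => ?_⟩
  · refine Function.bijective_iff_has_inverse.2 ⟨R (-(Real.pi * t)), hR _, fun x => ?_⟩
    simpa only [neg_neg] using hR (-(Real.pi * t)) x
  · rw [hR0]
    simp
  · rw [hR1]
    simp
  · rw [hR0]
    apply Complex.ext <;> simp
  · rw [hR1]
    apply Complex.ext <;> simp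

/-! ### Interpolation by circle homeomorphisms -/

/-- The lift of a circle homeomorphism that fixes `0`, with slope `N` to the right and slope `1 / N`
to the left of `0`. -/
noncomputable def steep (N φ : ℝ) : ℝ :=
  2 * Real.pi * (⌊φ / (2 * Real.pi)⌋ +
    min (N * Int.fract (φ / (2 * Real.pi))) (1 - (1 - Int.fract (φ / (2 * Real.pi))) / N))

lemma steep_zero {N : ℝ} (hN : 1 ≤ N) : steep N 0 = 0 := by
  have : 1 / N ≤ 1 := by rw [div_le_one (by linarith)]; exact hN
  have h : 0 ≤ 1 - 1 / N := by linarith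
  simp [steep] at h ⊢
  linarith

lemma isCircleLift_steep {N : ℝ} (hN : 1 ≤ N) : IsCircleLift (steep N) := by
  have hpi := Real.two_pi_pos
  have hN0 : 0 < N := by linarith
  set q : ℝ → ℝ := fun t => min (N * t) (1 - (1 - t) / N) with hq
  have hqm : StrictMono q := by
    intro a b h
    have : (1 - b) / N < (1 - a) / N := div_lt_div_of_pos_right (by linarith) hN0
    exact min_lt_min (mul_lt_mul_of_pos_left h hN0) (by linarith)
  have hq0 : q 0 = 0 := by
    have : 1 / N ≤ 1 := by rw [div_le_one hN0]; exact hN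
    simp only [hq]
    rw [mul_zero, min_eq_left]
    rw [sub_zero]
    linarith
  have hq1 : q 1 = 1 := by
    simp only [hq]
    rw [mul_one, sub_self, zero_div, sub_zero, min_eq_right hN]
  have hQ : ∀ φ, steep N φ = 2 * Real.pi *
      (⌊φ / (2 * Real.pi)⌋ + q (Int.fract (φ / (2 * Real.pi)))) := fun _ => rfl
  refine ⟨fun φ ψ h => ?_, ?_, fun φ => ?_⟩
  · rw [hQ, hQ]
    refine mul_lt_mul_of_pos_left ?_ hpi
    have h' : φ / (2 * Real.pi) < ψ / (2 * Real.pi) := div_lt_div_of_pos_right h hpi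
    rcases (Int.floor_mono h'.le).lt_or_eq with hf | hf
    · have h1 : q (Int.fract (φ / (2 * Real.pi))) < 1 := hq1 ▸ hqm (Int.fract_lt_one _)
      have h2 : 0 ≤ q (Int.fract (ψ / (2 * Real.pi))) :=
        hq0 ▸ hqm.monotone (Int.fract_nonneg _)
      have h3 : (⌊φ / (2 * Real.pi)⌋ : ℝ) + 1 ≤ ⌊ψ / (2 * Real.pi)⌋ := by exact_mod_cast hf
      linarith
    · rw [hf]
      have : Int.fract (φ / (2 * Real.pi)) < Int.fract (ψ / (2 * Real.pi)) := by
        rw [Int.fract, Int.fract, hf]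
        linarith
      linarith [hqm this]
  · have hc : Continuous ((fun t => q t - t) ∘ Int.fract) := by
      refine ContinuousOn.comp_fract'' (Continuous.continuousOn ?_) (by rw [hq0, hq1]; norm_num)
      simp only [hq]
      fun_prop
    have : steep N = fun φ => φ + 2 * Real.pi *
        ((fun t => q t - t) ∘ Int.fract) (φ / (2 * Real.pi)) := by
      funext φ
      rw [hQ]
      have := Int.floor_add_fract (φ / (2 * Real.pi))
      have h2 : 2 * Real.pi * (φ / (2 * Real.pi)) = φ := by field_simp
      simp only [Function.comp_apply]
      linear_combination 2 * Real.pi * this + h2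
    rw [this]
    exact continuous_id.add (continuous_const.mul (hc.comp (continuous_id.div_const _)))
  · have : (φ + 2 * Real.pi) / (2 * Real.pi) = φ / (2 * Real.pi) + 1 := by field_simp
    rw [hQ, hQ, this, Int.floor_add_one, Int.fract_add_one]
    push_cast
    ring

open Filter in
lemma eventually_lt_steep {d e : ℝ} (hd : 0 < d) (hd' : d < 2 * Real.pi) (he : e < 2 * Real.pi) :
    ∀ᶠ N in atTop, e < steep N d := by
  have hpi := Real.two_pi_pos
  have h1 : 0 < d / (2 * Real.pi) := div_pos hd hpi
  have h2 : d / (2 * Real.pi) < 1 := by rwa [div_lt_one hpi]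
  have hf : ⌊d / (2 * Real.pi)⌋ = 0 := Int.floor_eq_zero_iff.2 ⟨h1.le, h2⟩
  have hfr : Int.fract (d / (2 * Real.pi)) = d / (2 * Real.pi) := Int.fract_eq_self.2 ⟨h1.le, h2⟩
  have e1 : e / (2 * Real.pi) < 1 := by rwa [div_lt_one hpi]
  have t1 : ∀ᶠ N : ℝ in atTop, e / (2 * Real.pi) < N * (d / (2 * Real.pi)) :=
    (tendsto_id.atTop_mul_const h1).eventually_gt_atTop _
  have t2 : ∀ᶠ N : ℝ in atTop, e / (2 * Real.pi) < 1 - (1 - d / (2 * Real.pi)) / N := by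
    have : Tendsto (fun N : ℝ => 1 - (1 - d / (2 * Real.pi)) / N) atTop (𝓝 (1 - 0)) :=
      tendsto_const_nhds.sub (tendsto_id.const_div_atTop _)
    rw [sub_zero] at this
    exact this.eventually_const_lt e1
  filter_upwards [t1, t2] with N h1 h2
  rw [steep, hf, hfr, Int.cast_zero, zero_add, ← div_lt_iff₀' hpi]
  exact lt_min h1 h2

/-- Two families of angular coordinates, each of them without repetitions modulo `2π`, are in the
same cyclic order, and their lifts to the real line are in the same order as well. -/
def SameCyclic {ι : Type*} (x y : ι → ℝ) : Prop :=
  ∀ i j, i ≠ j → ∃ m : ℤ,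
    (x i < x j + 2 * Real.pi * m ∧ x j + 2 * Real.pi * m < x i + 2 * Real.pi) ∧
      y i < y j + 2 * Real.pi * m ∧ y j + 2 * Real.pi * m < y i + 2 * Real.pi

namespace SameCyclic

variable {ι : Type*} {x y : ι → ℝ}

lemma neg (h : SameCyclic x y) : SameCyclic (fun i => -x i) (fun i => -y i) := fun i j hij => by
  obtain ⟨m, ⟨h1, h2⟩, h3, h4⟩ := h j i hij.symm
  refine ⟨m, ⟨?_, ?_⟩, ?_, ?_⟩ <;> linarith

lemma of_or (h : ∀ i j, i ≠ j →
    ((x i < x j ∧ x j < x i + 2 * Real.pi) ∧ y i < y j ∧ y j < y i + 2 * Real.pi) ∨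
      (x j < x i ∧ x i < x j + 2 * Real.pi) ∧ y j < y i ∧ y i < y j + 2 * Real.pi) :
    SameCyclic x y := by
  intro i j hij
  obtain h | ⟨⟨h1, h2⟩, h3, h4⟩ := h i j hij
  · exact ⟨0, by simpa using h⟩
  · refine ⟨1, ⟨?_, ?_⟩, ?_, ?_⟩ <;> push_cast <;> linarith

end SameCyclic

/-- Points of the circle that depend continuously on a parameter can locally be carried to points in
the same cyclic order by circle homeomorphisms depending continuously on the parameter. The
homeomorphism is the infimum of the maps `φ ↦ y i + steep N (φ - x i)`: for large `N` all of these
are at least `y j` at `x j`. -/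
theorem exists_local_circleLift {X ι : Type*} [TopologicalSpace X] [Finite ι] {x y : ι → X → ℝ}
    (hx : ∀ i, Continuous (x i)) (hy : ∀ i, Continuous (y i)) {z₀ : X}
    (h : SameCyclic (fun i => x i z₀) fun i => y i z₀) :
    ∃ g : X → ℝ → ℝ, (Continuous fun p : X × ℝ => g p.1 p.2) ∧ (∀ z, IsCircleLift (g z)) ∧
      ∀ᶠ z in 𝓝 z₀, ∀ i, g z (x i z) = y i z := by
  cases isEmpty_or_nonempty ι
  · exact ⟨fun _ φ => φ, continuous_snd, fun _ => IsCircleLift.id,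
      Filter.Eventually.of_forall fun _ i => isEmptyElim i⟩
  have := Fintype.ofFinite ι
  obtain ⟨N, hN1, hN⟩ : ∃ N : ℝ, 1 ≤ N ∧
      ∀ i j, i ≠ j → y j z₀ < y i z₀ + steep N (x j z₀ - x i z₀) := by
    have hev : ∀ᶠ N : ℝ in Filter.atTop, 1 ≤ N ∧
        ∀ i j, i ≠ j → y j z₀ < y i z₀ + steep N (x j z₀ - x i z₀) := by
      refine (Filter.eventually_ge_atTop 1).and (Filter.eventually_all.2 fun i =>
        Filter.eventually_all.2 fun j => ?_)
      by_cases hij : i = j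
      · exact Filter.Eventually.of_forall fun _ h => absurd hij h
      obtain ⟨m, ⟨h1, h2⟩, h3, h4⟩ := h i j hij
      filter_upwards [Filter.eventually_ge_atTop 1, eventually_lt_steep
        (d := x j z₀ - x i z₀ + 2 * Real.pi * m) (e := y j z₀ - y i z₀ + 2 * Real.pi * m)
        (by linarith) (by linarith) (by linarith)] with N hN1 hN _
      rw [(isCircleLift_steep hN1).map_add_int] at hN
      linarith
    exact hev.exists
  have hQ := isCircleLift_steep hN1
  have hne : (Finset.univ : Finset ι).Nonempty := Finset.univ_nonempty
  let g : X → ℝ → ℝ := fun z φ => Finset.univ.inf' hne fun i => y i z + steep N (φ - x i z)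
  have hle : ∀ z φ i, g z φ ≤ y i z + steep N (φ - x i z) := fun z φ i =>
    Finset.inf'_le _ (Finset.mem_univ i)
  have hex : ∀ z φ, ∃ i, g z φ = y i z + steep N (φ - x i z) := fun z φ => by
    obtain ⟨i, -, hi⟩ := Finset.exists_mem_eq_inf' hne fun i => y i z + steep N (φ - x i z)
    exact ⟨i, hi⟩
  have hterm : ∀ i, Continuous fun p : X × ℝ => y i p.1 + steep N (p.2 - x i p.1) := fun i =>
    ((hy i).comp continuous_fst).add
      (hQ.continuous.comp (continuous_snd.sub ((hx i).comp continuous_fst)))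
  have hgc : Continuous fun p : X × ℝ => g p.1 p.2 :=
    Continuous.finset_inf'_apply hne fun i _ => hterm i
  refine ⟨g, hgc, fun z => ⟨fun φ ψ hlt => ?_, ?_, fun φ => ?_⟩, ?_⟩
  · obtain ⟨i, hi⟩ := hex z ψ
    rw [hi]
    have := hQ.strictMono (show φ - x i z < ψ - x i z by linarith)
    linarith [hle z φ i]
  · exact hgc.comp (Continuous.prodMk_right z)
  · have hadd : ∀ i, steep N (φ + 2 * Real.pi - x i z) = steep N (φ - x i z) + 2 * Real.pi :=
      fun i => by rw [← hQ.map_add]; congr 1; ring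
    apply le_antisymm
    · obtain ⟨i, hi⟩ := hex z φ
      have := hle z (φ + 2 * Real.pi) i
      rw [hadd] at this
      linarith
    · obtain ⟨i, hi⟩ := hex z (φ + 2 * Real.pi)
      have := hle z φ i
      rw [hadd] at hi
      linarith
  · have hev : ∀ᶠ z in 𝓝 z₀, ∀ i j, i ≠ j → y j z < y i z + steep N (x j z - x i z) := by
      refine Filter.eventually_all.2 fun i => Filter.eventually_all.2 fun j => ?_
      by_cases hij : i = j
      · exact Filter.Eventually.of_forall fun _ h => absurd hij h
      have hc : Continuous fun z => y i z + steep N (x j z - x i z) :=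
        (hy i).add (hQ.continuous.comp ((hx j).sub (hx i)))
      filter_upwards [(hy j).continuousAt.eventually_lt hc.continuousAt (hN i j hij)] with z hz _
      exact hz
    filter_upwards [hev] with z hz j
    apply le_antisymm
    · simpa [steep_zero hN1] using hle z (x j z) j
    · obtain ⟨i, hi⟩ := hex z (x j z)
      rw [hi]
      by_cases hij : i = j
      · simp [hij, steep_zero hN1]
      · exact (hz i j hij).le

theorem SameCyclic.exists_circleLift {ι : Type*} [Finite ι] {x y : ι → ℝ} (h : SameCyclic x y) :
    ∃ g, IsCircleLift g ∧ ∀ i, g (x i) = y i := by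
  obtain ⟨g, -, hg, hev⟩ := exists_local_circleLift (X := Unit) (z₀ := ())
    (x := fun i _ => x i) (y := fun i _ => y i) (fun _ => continuous_const)
    (fun _ => continuous_const) h
  exact ⟨g (), hg (), hev.self_of_nhds⟩

lemma exists_continuous_norm_lt_one {ι : Type*} [Finite ι] {u : ι → ℂ} (hu : Function.Injective u)
    {v : ι → ℂ} (hv : ∀ i, ‖v i‖ < 1) :
    ∃ m : C(ℂ, ℂ), (∀ z, ‖m z‖ < 1) ∧ ∀ i, m (u i) = v i := by
  have key : ∃ m : C(ℂ, ℂ), ∀ z, m z ∈ {w : ℂ | ‖w‖ < 1 ∧ ∀ i, z = u i → w = v i} := by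
    refine exists_continuous_forall_mem_convex_of_local_const (fun z => ?_) fun z => ?_
    · have h1 : Convex ℝ {w : ℂ | ‖w‖ < 1} := by
        simpa [Metric.ball, dist_zero_right] using convex_ball (0 : ℂ) 1
      refine h1.inter ?_
      rintro w hw w' hw' α β - - hαβ i hi
      rw [hw i hi, hw' i hi, ← add_smul, hαβ, one_smul]
    · have hU : ∀ᶠ z' in 𝓝 z, ∀ i, z' = u i → z = u i := by
        refine Filter.eventually_all.2 fun i => ?_
        by_cases hi : z = u i
        · exact Filter.Eventually.of_forall fun _ _ => hi
        · filter_upwards [isOpen_ne.mem_nhds hi] with z' h h'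
          exact absurd h' h
      by_cases hz : ∃ i, z = u i
      · obtain ⟨i, rfl⟩ := hz
        refine ⟨v i, hU.mono fun z' h => ⟨hv i, fun j hj => ?_⟩⟩
        rw [hu (h j hj)]
      · exact ⟨0, hU.mono fun z' h => ⟨by simp, fun j hj => absurd ⟨j, h j hj⟩ hz⟩⟩
  obtain ⟨m, hm⟩ := key
  exact ⟨m, fun z => (hm z).1, fun i => (hm _).2 i rfl⟩

variable {n s : ℕ}

/-! ### Chords of the boundary circle -/

namespace Layout

variable (L : Layout n s)

lemma position_eq_cis (a : Fin n) : L.position a = cis (-L.vertexAngle a) := by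
  simp [position, cis]

@[simp] lemma norm_position (a : Fin n) : ‖L.position a‖ = 1 := by
  rw [position_eq_cis, norm_cis]

lemma position_injective : Function.Injective L.position := by
  intro a b h
  rw [position_eq_cis, position_eq_cis] at h
  have h1 := L.vertexAngle_lt a b
  have h2 := L.vertexAngle_lt b a
  exact L.vertexAngle_strictMono.injective
    (neg_injective (eq_of_cis_eq h (by linarith) (by linarith)))

lemma chord_mk {a b : Fin n} (h : s(a, b) ∈ (⊤ : SimpleGraph (Fin n)).edgeSet) :
    L.chord ⟨s(a, b), h⟩ = segment ℝ (L.position a) (L.position b) := by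
  have : {c | c ∈ s(a, b)} = {a, b} := by ext; simp
  rw [chord, this, image_pair, convexHull_pair]

lemma isClosed_chord (e : Edge n) : IsClosed (L.chord e) :=
  ((Set.toFinite _).image _).isClosed_convexHull ℝ

end Layout

lemma mem_segment_iff_midpoint {p q z : ℂ} :
    z ∈ segment ℝ p q ↔
      z ∈ segment ℝ ((1 / 2 : ℝ) • (p + q)) p ∨ z ∈ segment ℝ ((1 / 2 : ℝ) • (p + q)) q := by
  have hm : (1 / 2 : ℝ) • (p + q) ∈ segment ℝ p q :=
    ⟨1 / 2, 1 / 2, by norm_num, by norm_num, by norm_num, by rw [smul_add]⟩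
  constructor
  · rintro ⟨α, β, hα, hβ, h, rfl⟩
    rcases le_total β α with hab | hab
    · refine Or.inl ⟨2 * β, α - β, by linarith, by linarith, by linarith, ?_⟩
      module
    · refine Or.inr ⟨2 * α, β - α, by linarith, by linarith, by linarith, ?_⟩
      module
  · rintro (h | h)
    · exact (convex_segment p q).segment_subset hm (left_mem_segment ℝ p q) h
    · exact (convex_segment p q).segment_subset hm (right_mem_segment ℝ p q) h

lemma Edge.exists_mk (e : Edge n) : ∃ a b : Fin n, a < b ∧ (e : Sym2 (Fin n)) = s(a, b) := by
  obtain ⟨e, he⟩ := e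
  induction e using Sym2.ind with
  | _ a b =>
    have hab : a ≠ b := by simpa using he
    rcases hab.lt_or_gt with h | h
    · exact ⟨a, b, h, rfl⟩
    · exact ⟨b, a, h, Sym2.eq_swap⟩

lemma Layout.chord_eq (L : Layout n s) {e : Edge n} {a b : Fin n}
    (h : (e : Sym2 (Fin n)) = s(a, b)) :
    L.chord e = segment ℝ (L.position a) (L.position b) := by
  obtain ⟨e, he⟩ := e
  subst h
  exact L.chord_mk he

/-- The midpoint of a chord cuts it into two segments that end at the vertices. -/
lemma Layout.exists_midpoint (L : Layout n s) (e : Edge n) :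
    ∃ m : ℂ, ‖m‖ < 1 ∧
      ∀ z, z ∈ L.chord e ↔ ∃ a ∈ (e : Sym2 (Fin n)), z ∈ segment ℝ m (L.position a) := by
  obtain ⟨a, b, hab, he⟩ := e.exists_mk
  refine ⟨(1 / 2 : ℝ) • (L.position a + L.position b), ?_, fun z => ?_⟩
  · have := (norm_midpoint_lt_iff (x := L.position a) (y := L.position b) (by simp)).2
      (L.position_injective.ne hab.ne)
    simpa using this
  · rw [L.chord_eq he, mem_segment_iff_midpoint, he]
    simp

/-- The left hand side is the signed distance of the point of angle `ξ` of the unit circle from the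
chord between the points of angles `α` and `β`. -/
lemma cos_sub_cos_half (α β ξ : ℝ) :
    Real.cos ((α + β) / 2 - ξ) - Real.cos ((β - α) / 2) =
      2 * Real.sin ((β - ξ) / 2) * Real.sin ((ξ - α) / 2) := by
  rw [Real.cos_sub_cos, show ((α + β) / 2 - ξ + (β - α) / 2) / 2 = (β - ξ) / 2 by ring,
    show ((α + β) / 2 - ξ - (β - α) / 2) / 2 = -((ξ - α) / 2) by ring, Real.sin_neg]
  ring

/-- Two chords that meet in the open disk belong to crossing edges: the endpoints of the second one
lie strictly on different sides of the first one. -/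
theorem Layout.crosses_of_mem_chord (L : Layout n s) {e f : Edge n} (hef : e ≠ f) {z : ℂ}
    (hz : ‖z‖ < 1) (he : z ∈ L.chord e) (hf : z ∈ L.chord f) : Crosses e f := by
  obtain ⟨a, c, hac, hea⟩ := e.exists_mk
  obtain ⟨b, d, hbd, hfb⟩ := f.exists_mk
  rw [L.chord_eq hea] at he
  rw [L.chord_eq hfb] at hf
  set α := L.vertexAngle with hα
  let side : ℂ → ℝ := fun w => (w * cis ((α a + α c) / 2)).re - Real.cos ((α c - α a) / 2)
  have hside : ∀ x, side (L.position x) =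
      2 * Real.sin ((α c - α x) / 2) * Real.sin ((α x - α a) / 2) := by
    intro x
    rw [← cos_sub_cos_half]
    simp only [side]
    rw [L.position_eq_cis, ← cis_add, cis, Complex.exp_ofReal_mul_I_re]
    congr 2
    ring
  have haff : ∀ (t t' : ℝ) (p q : ℂ), t + t' = 1 →
      side (t • p + t' • q) = t * side p + t' * side q := by
    intro t t' p q h
    simp only [side, Complex.real_smul, add_mul, mul_assoc, Complex.add_re, Complex.re_ofReal_mul]
    linear_combination Real.cos ((α c - α a) / 2) * h
  have hsin : ∀ {x y : Fin n}, x < y → 0 < Real.sin ((α y - α x) / 2) := by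
    intro x y h
    have h1 := L.vertexAngle_strictMono h
    have h2 := L.vertexAngle_lt x y
    exact Real.sin_pos_of_pos_of_lt_pi (by linarith) (by linarith)
  have hsin' : ∀ {x y : Fin n}, x < y → Real.sin ((α x - α y) / 2) < 0 := by
    intro x y h
    have := hsin h
    rw [show (α x - α y) / 2 = -((α y - α x) / 2) by ring, Real.sin_neg]
    linarith
  have hpos : ∀ x, a < x → x < c → 0 < side (L.position x) := fun x h1 h2 => by
    rw [hside]
    exact mul_pos (mul_pos two_pos (hsin h2)) (hsin h1)
  have hneg : ∀ x, x < a ∨ c < x → side (L.position x) < 0 := by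
    rintro x (h | h)
    · rw [hside]
      exact mul_neg_of_pos_of_neg (mul_pos two_pos (hsin (h.trans hac))) (hsin' h)
    · rw [hside]
      exact mul_neg_of_neg_of_pos (by linarith [hsin' h]) (hsin (hac.trans h))
  have hzero : ∀ x, x = a ∨ x = c → side (L.position x) = 0 := by
    rintro x (rfl | rfl) <;> rw [hside] <;> simp
  have hz0 : side z = 0 := by
    obtain ⟨t, t', -, -, h, rfl⟩ := he
    rw [haff _ _ _ _ h, hzero a (Or.inl rfl), hzero c (Or.inr rfl)]
    simp
  obtain ⟨t, t', ht, ht', h, rfl⟩ := hf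
  -- an endpoint of the second chord is not in the open disk
  have ht0 : 0 < t := ht.lt_of_ne' fun h0 => by
    have h1 : t' = 1 := by linarith
    simp [h0, h1] at hz
  have ht0' : 0 < t' := ht'.lt_of_ne' fun h0 => by
    have h1 : t = 1 := by linarith
    simp [h0, h1] at hz
  rw [haff _ _ _ _ h] at hz0
  have hcase : ∀ x, (a < x ∧ x < c) ∨ (x < a ∨ c < x) ∨ (x = a ∨ x = c) := by
    intro x
    omega
  have swap2 : ∀ x y : Fin n, s(x, y) = s(y, x) := fun _ _ => Sym2.eq_swap
  rcases hcase b with ⟨h1, h2⟩ | h1 | h1 <;> rcases hcase d with ⟨h3, h4⟩ | h3 | h3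
  · nlinarith [hpos b h1 h2, hpos d h3 h4]
  · rcases h3 with h3 | h3
    · exact ⟨d, a, b, c, h3, h1, h2, Or.inr ⟨hea, hfb.trans (swap2 _ _)⟩⟩
    · exact ⟨a, b, c, d, h1, h2, h3, Or.inl ⟨hea, hfb⟩⟩
  · nlinarith [hpos b h1 h2, hzero d h3]
  · rcases h1 with h1 | h1
    · exact ⟨b, a, d, c, h1, h3, h4, Or.inr ⟨hea, hfb⟩⟩
    · exact ⟨a, d, c, b, h3, h4, h1, Or.inl ⟨hea, hfb.trans (swap2 _ _)⟩⟩
  · nlinarith [hneg b h1, hneg d h3]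
  · nlinarith [hneg b h1, hzero d h3]
  · nlinarith [hzero b h1, hpos d h3 h4]
  · nlinarith [hzero b h1, hneg d h3]
  · exfalso
    apply hef
    apply Subtype.ext
    rw [hea, hfb]
    rcases h1 with rfl | rfl <;> rcases h3 with rfl | rfl
    · exact absurd hbd (lt_irrefl _)
    · rfl
    · exact swap2 _ _
    · exact absurd hbd (lt_irrefl _)

/-! ### Arc presentations -/

/-- The arc presentation of `K_n` with vertex angles `α` and edge angles `ψ`. The 3-sphere is the
join of the circles `w = 0` and `z = 0`. Vertex `a` is the point of angle `α a` of the first circle,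
and the edge `e` is the union of the two segments of the join from the point of angle `ψ e` of the
second circle to the endpoints of `e`. In the page of angle `ψ e` these are two radii. -/
noncomputable def arc (α : Fin n → ℝ) (ψ : Edge n → ℝ) : SpatialGraph n where
  vertex a := S3.mk (cis (α a)) 0 (by simp)
  edge e := {x | x.1 1 = ‖x.1 1‖ * cis (ψ e) ∧
    ∃ a ∈ (e : Sym2 (Fin n)), x.1 0 = ‖x.1 0‖ * cis (α a)}

/-- The graph whose edges are straight chords, as in a book representation, and in which the edge
`e` lies in the half-plane of constant angle `ψ e`. -/
noncomputable def Layout.chordGraph (L : Layout n s) (ψ : Edge n → ℝ) : SpatialGraph n where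
  vertex := L.vertexPoint
  edge e := {x | x.1 1 = ‖x.1 1‖ * cis (ψ e) ∧ x.1 0 ∈ L.chord e}

/-- The edge angles `ψ` are distinct on the circle, and they put crossing edges in the order given
by the sheets. -/
def Compatible (A : Edge n → Fin s) (ψ : Edge n → ℝ) : Prop :=
  (Function.Injective fun e => cis (ψ e)) ∧
    ∀ e f, Crosses e f → A e < A f → ψ e < ψ f ∧ ψ f < ψ e + 2 * Real.pi

lemma Crosses.symm {e f : Edge n} (h : Crosses e f) : Crosses f e := by
  obtain ⟨a, b, c, d, h1, h2, h3, h | h⟩ := h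
  · exact ⟨a, b, c, d, h1, h2, h3, Or.inr h.symm⟩
  · exact ⟨a, b, c, d, h1, h2, h3, Or.inl h.symm⟩

/-- `exists_twist` with the roles of the coordinates exchanged. -/
lemma exists_twist_swap (g : ℂ → ℝ → ℝ)
    (hc : ContinuousOn (fun p : ℂ × ℝ => g p.1 p.2) (Metric.ball 0 1 ×ˢ univ))
    (hg : ∀ w ∈ Metric.ball (0 : ℂ) 1, IsCircleLift (g w)) :
    ∃ F, IsotopicToId F ∧ (∀ x, (F x).1 1 = x.1 1) ∧
      ∀ (x : S3) (φ : ℝ), (F x).1 0 = ‖(F x).1 0‖ * cis (g (x.1 1) φ) ↔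
        x.1 0 = ‖x.1 0‖ * cis φ := by
  obtain ⟨F, hF, h0, h1⟩ := exists_twist g hc hg
  exact ⟨_, hF.conj_swap, fun x => h0 _, fun x φ => h1 (S3.swap x) φ⟩

lemma S3.norm_zero_eq_of_one_eq {x y : S3} (h : ‖x.1 1‖ = ‖y.1 1‖) : ‖x.1 0‖ = ‖y.1 0‖ := by
  have h1 := S3.norm_sq_add x
  have h2 := S3.norm_sq_add y
  rw [h] at h1
  exact (sq_eq_sq₀ (norm_nonneg _) (norm_nonneg _)).1 (by linarith)

/-- Rotating the first coordinate by a circle homeomorphism carries arc presentations to each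
other. -/
theorem arc_ambientIsotopicVia {σ : Equiv.Perm (Fin n)} {α α' y : Fin n → ℝ} {ψ ψ' : Edge n → ℝ}
    (h : SameCyclic α y) (hy : ∀ a, cis (y a) = cis (α' (σ a)))
    (hψ : ∀ e, cis (ψ' (edgePerm σ e)) = cis (ψ e)) :
    (arc α ψ).AmbientIsotopicVia σ (arc α' ψ') := by
  obtain ⟨g, hg, hgα⟩ := h.exists_circleLift
  obtain ⟨F, hF, h1, h0⟩ := exists_twist_swap (fun _ => g)
    (hg.continuous.comp continuous_snd).continuousOn fun _ _ => hg
  have hα : ∀ a, cis (α' (σ a)) = cis (g (α a)) := fun a => by rw [hgα, hy]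
  refine .of_isotopicToId hF (fun a => S3.ext ?_ (h1 _)) fun e x => ?_
  · have hn : ‖(F ((arc α ψ).vertex a)).1 0‖ = 1 := by
      rw [S3.norm_zero_eq_of_one_eq (congrArg _ (h1 _))]
      simp [arc]
    have := (h0 ((arc α ψ).vertex a) (α a)).2 (by simp [arc])
    rw [hn] at this
    rw [this, ← hα]
    simp [arc]
  · simp only [arc, mem_ofPred_eq, h1, hψ]
    refine and_congr_right fun _ => ?_
    constructor
    · rintro ⟨a, ha, h⟩
      obtain ⟨a, rfl⟩ := σ.surjective a
      refine ⟨a, mem_edgePerm.1 ha, (h0 x _).1 ?_⟩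
      rw [← hα]
      exact h
    · rintro ⟨a, ha, h⟩
      refine ⟨σ a, mem_edgePerm.2 ha, ?_⟩
      rw [hα]
      exact (h0 x _).2 h

/-- The two radii that form an edge in an arc presentation are pushed to the two halves of the
chord, in all pages at the same time. -/
theorem Layout.arc_ambientIsotopicVia_chordGraph (L : Layout n s) {ψ : Edge n → ℝ}
    (hψ : Function.Injective fun e => cis (ψ e)) :
    (arc (fun a => -L.vertexAngle a) ψ).AmbientIsotopicVia 1 (L.chordGraph ψ) := by
  choose c hc1 hc using L.exists_midpoint
  obtain ⟨m, hm1, hm⟩ := exists_continuous_norm_lt_one hψ hc1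
  obtain ⟨F, hF, h1, h0⟩ := exists_push m hm1
  refine .of_isotopicToId hF (fun a => ?_) fun e x => ?_
  · have hv : ((arc (fun a => -L.vertexAngle a) ψ).vertex a).1 1 = 0 := rfl
    have h00 : ((arc (fun a => -L.vertexAngle a) ψ).vertex a).1 0 = L.position a :=
      (L.position_eq_cis a).symm
    have hz := h0 _ 1 (by simp) (show _ by rw [hv]; simp)
    rw [h00, coneMap_of_norm_eq_one (L.norm_position a)] at hz
    refine S3.ext hz ?_
    change _ = 0
    by_contra hne
    have := (S3.norm_zero_lt_iff _).2 hne
    rw [hz, L.norm_position] at this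
    exact lt_irrefl _ this
  · rw [edgePerm_one]
    simp only [arc, chordGraph, mem_ofPred_eq]
    rw [h1 x _ (norm_cis _)]
    refine and_congr_right fun hx => ?_
    rw [h0 x _ (norm_cis _) hx, hm e, hc]
    refine exists_congr fun a => and_congr_right fun _ => ?_
    rw [coneMap_mem_segment_iff (hc1 e) (L.norm_position a), L.position_eq_cis]
    exact and_iff_right (S3.norm_zero_le x)

/-- In the circle over a point `z` of the open disk, the edges over `z` pairwise cross, hence they
lie in different sheets, in the order of the angles `ψ`. So there is a circle homeomorphism that
moves each edge over `z` to its new angle. The set of its possible lifts is convex, so lifts can be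
chosen continuously in `z`. -/
theorem Layout.graph_ambientIsotopicVia_chordGraph (L : Layout n s) {A : Edge n → Fin s}
    (hA : IsBook A) {ψ : Edge n → ℝ} (hψ : Compatible A ψ) :
    (L.graph A).AmbientIsotopicVia 1 (L.chordGraph ψ) := by
  let X := Metric.ball (0 : ℂ) 1
  have hθ : ∀ j, Continuous fun z : X => L.sheetAngle j z := fun j =>
    continuousOn_iff_continuous_domRestrict.1 (L.continuousOn_sheetAngle j)
  let T : X → Set C(ℝ, ℝ) := fun z => {g | IsCircleLift g ∧
    ∀ e, (z : ℂ) ∈ L.chord e → g (L.sheetAngle (A e) z) = ψ e}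
  have hconv : ∀ z, Convex ℝ (T z) := by
    rintro z g ⟨hg, hg'⟩ k ⟨hk, hk'⟩ a b ha hb hab
    refine ⟨hg.convexComb hk ha hb hab, fun e he => ?_⟩
    simp only [ContinuousMap.add_apply, ContinuousMap.smul_apply, smul_eq_mul]
    rw [hg' e he, hk' e he, ← add_mul, hab, one_mul]
  have hloc : ∀ z, ∃ U ∈ 𝓝 z, ∃ g : X → C(ℝ, ℝ), ContinuousOn g U ∧ ∀ y ∈ U, g y ∈ T y := by
    intro z
    have hsc : SameCyclic (fun e : {e // (z : ℂ) ∈ L.chord e} => L.sheetAngle (A e) z)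
        fun e => ψ e := by
      refine SameCyclic.of_or fun e f hef => ?_
      have hz : (z : ℂ) ∈ Metric.ball (0 : ℂ) 1 := z.2
      have hcr := L.crosses_of_mem_chord (Subtype.coe_injective.ne hef) (mem_ball_zero_iff.1 hz) e.2 f.2
      have hne : A e ≠ A f := fun h => hA _ _ h hcr
      rcases hne.lt_or_gt with h | h
      · exact Or.inl ⟨⟨L.sheetAngle_strictMono z hz h, L.sheetAngle_lt z hz _ _⟩,
          hψ.2 _ _ hcr h⟩
      · exact Or.inr ⟨⟨L.sheetAngle_strictMono z hz h, L.sheetAngle_lt z hz _ _⟩,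
          hψ.2 _ _ hcr.symm h⟩
    obtain ⟨g, hgc, hg, hgz⟩ := exists_local_circleLift (z₀ := z)
      (x := fun (e : {e // (z : ℂ) ∈ L.chord e}) (y : X) => L.sheetAngle (A e) y)
      (y := fun e _ => ψ e) (fun e => hθ _) (fun _ => continuous_const) hsc
    have hch : ∀ᶠ y : X in 𝓝 z, ∀ e, (y : ℂ) ∈ L.chord e → (z : ℂ) ∈ L.chord e := by
      refine Filter.eventually_all.2 fun e => ?_
      by_cases he : (z : ℂ) ∈ L.chord e
      · exact Filter.Eventually.of_forall fun _ _ => he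
      · have : ∀ᶠ y : X in 𝓝 z, (y : ℂ) ∉ L.chord e :=
          continuous_subtype_val.continuousAt.eventually_mem
            ((L.isClosed_chord e).isOpen_compl.mem_nhds he)
        filter_upwards [this] with y hy h
        exact absurd h hy
    refine ⟨_, hch.and hgz, ContinuousMap.curry ⟨fun p => g p.1 p.2, hgc⟩,
      (ContinuousMap.continuous _).continuousOn, fun y hy => ⟨hg y, fun e he => ?_⟩⟩
    exact hy.2 ⟨e, hy.1 e he⟩
  obtain ⟨G, hG⟩ := exists_continuous_forall_mem_convex_of_local hconv hloc
  classical
  let g : ℂ → ℝ → ℝ := fun z φ => if h : z ∈ X then G ⟨z, h⟩ φ else φ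
  have hgG : ∀ (z : ℂ) (h : z ∈ X), g z = G ⟨z, h⟩ := fun z h => by
    funext φ
    simp only [g, dif_pos h]
  have hgc : ContinuousOn (fun p : ℂ × ℝ => g p.1 p.2) (X ×ˢ univ) := by
    rw [continuousOn_iff_continuous_domRestrict]
    have : (X ×ˢ univ).domRestrict (fun p : ℂ × ℝ => g p.1 p.2) =
        fun p => G ⟨p.1.1, p.2.1⟩ p.1.2 := by
      funext p
      exact congrFun (hgG _ p.2.1) _
    rw [this]
    refine Continuous.eval (G.continuous.comp ?_) (by fun_prop)
    exact Continuous.subtype_mk (by fun_prop) _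
  obtain ⟨F, hF, h0, h1⟩ := exists_twist g hgc fun z hz => by
    rw [hgG z hz]
    exact (hG ⟨z, hz⟩).1
  have hne : ∀ x : S3, (F x).1 1 = 0 ↔ x.1 1 = 0 := fun x => by
    rw [← not_iff_not, ← ne_eq, ← ne_eq, ← S3.norm_zero_lt_iff, ← S3.norm_zero_lt_iff, h0]
  refine .of_isotopicToId hF (fun a => S3.ext (h0 _) ?_) fun e x => ?_
  · change _ = 0
    rw [hne]
    rfl
  · rw [edgePerm_one]
    simp only [graph, Layout.chordGraph, sheet, mem_ofPred_eq, h0]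
    refine and_congr_left fun he => ?_
    by_cases hx : x.1 1 = 0
    · simp [hx, (hne x).2 hx]
    · have hz : x.1 0 ∈ X := by simpa [X] using (S3.norm_zero_lt_iff x).2 hx
      have := h1 x (L.sheetAngle (A e) (x.1 0))
      rwa [hgG _ hz, (hG ⟨_, hz⟩).2 e he] at this

/-- A book representation has an arc presentation with any compatible edge angles. -/
theorem Layout.graph_ambientIsotopicVia_arc (L : Layout n s) {A : Edge n → Fin s}
    (hA : IsBook A) {ψ : Edge n → ℝ} (hψ : Compatible A ψ) :
    (L.graph A).AmbientIsotopicVia 1 (arc (fun a => -L.vertexAngle a) ψ) := by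
  simpa using (L.graph_ambientIsotopicVia_chordGraph hA hψ).trans
    (L.arc_ambientIsotopicVia_chordGraph hψ.1).symm

/-- To compare two book representations it is enough to compare arc presentations. -/
theorem isotopicVia_of_arc {s' : ℕ} {σ : Equiv.Perm (Fin n)} {A : Edge n → Fin s}
    {A' : Edge n → Fin s'} (hA : IsBook A) (hA' : IsBook A') {ψ ψ' : Edge n → ℝ}
    (hψ : Compatible A ψ) (hψ' : Compatible A' ψ')
    (h : ∀ (L : Layout n s) (L' : Layout n s'),
      (arc (fun a => -L.vertexAngle a) ψ).AmbientIsotopicVia σ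
        (arc (fun a => -L'.vertexAngle a) ψ')) : IsotopicVia σ A A' := fun L L' => by
  simpa using ((L.graph_ambientIsotopicVia_arc hA hψ).trans (h L L')).trans
    (L'.graph_ambientIsotopicVia_arc hA' hψ').symm

/-! ### Exchanging two vertices of an arc presentation -/

/-- `exists_push` with the roles of the coordinates exchanged. -/
lemma exists_push_swap (m : C(ℂ, ℂ)) (hm : ∀ u, ‖m u‖ < 1) :
    ∃ F, IsotopicToId F ∧
      (∀ (x : S3) (u : ℂ), ‖u‖ = 1 → ((F x).1 0 = ‖(F x).1 0‖ * u ↔ x.1 0 = ‖x.1 0‖ * u)) ∧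
      ∀ (x : S3) (u : ℂ), ‖u‖ = 1 → x.1 0 = ‖x.1 0‖ * u → (F x).1 1 = coneMap (m u) (x.1 1) := by
  obtain ⟨F, hF, h1, h0⟩ := exists_push m hm
  exact ⟨_, hF.conj_swap, fun x u hu => h1 (S3.swap x) u hu, fun x u hu h => h0 (S3.swap x) u hu h⟩

/-- A function on the open disk that is at least `1` on all segments from `1/2` to a point of the
right half of the unit circle, and at most `-1` on all segments from `-1/2` to a point of the left
half. -/
noncomputable def tilt (w : ℂ) : ℝ := 3 * w.re / (1 - ‖w‖)

lemma continuousOn_tilt : ContinuousOn tilt (Metric.ball 0 1) := by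
  refine ContinuousOn.div (by fun_prop) (by fun_prop) fun w hw => ?_
  rw [mem_ball_zero_iff] at hw
  linarith

lemma one_le_tilt {u w : ℂ} (hu : ‖u‖ = 1) (hre : 0 ≤ u.re) (hw : ‖w‖ < 1)
    (h : w ∈ segment ℝ (1 / 2) u) : 1 ≤ tilt w := by
  obtain ⟨a, b, ha, hb, hab, rfl⟩ := h
  rw [tilt, le_div_iff₀ (by linarith)]
  -- the distance to the circle is at most the distance to `u`, which is at most `3 / 2 * a`
  have h1 : ‖u‖ - ‖a • (1 / 2 : ℂ) + b • u‖ ≤ ‖u - (a • (1 / 2 : ℂ) + b • u)‖ :=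
    norm_sub_norm_le _ _
  have h2 : u - (a • (1 / 2 : ℂ) + b • u) = a • (u - 1 / 2) := by
    rw [← sub_eq_of_eq_add' hab.symm]
    module
  have h3 : ‖u - 1 / 2‖ ≤ 3 / 2 := (norm_sub_le _ _).trans (by rw [hu]; norm_num)
  rw [h2, norm_smul, Real.norm_of_nonneg ha, hu] at h1
  have h4 : (a • (1 / 2 : ℂ) + b • u).re = a * (1 / 2) + b * u.re := by
    simp
  rw [h4]
  nlinarith [mul_nonneg hb hre]

lemma tilt_neg (w : ℂ) : tilt (-w) = -tilt w := by
  simp [tilt, neg_div]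

lemma tilt_le_neg_one {u w : ℂ} (hu : ‖u‖ = 1) (hre : u.re ≤ 0) (hw : ‖w‖ < 1)
    (h : w ∈ segment ℝ (-(1 / 2)) u) : tilt w ≤ -1 := by
  have h' : -w ∈ segment ℝ (1 / 2) (-u) := by
    obtain ⟨a, b, ha, hb, hab, rfl⟩ := h
    exact ⟨a, b, ha, hb, hab, by module⟩
  have := one_le_tilt (u := -u) (by simpa using hu) (by simpa using hre) (by simpa using hw) h'
  rw [tilt_neg] at this
  linarith

/-- Linear interpolation between the lifts `gm` at `-1`, the identity at `0` and `gp` at `1`. -/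
noncomputable def blend (gm gp : ℝ → ℝ) (κ φ : ℝ) : ℝ :=
  max (min κ 1) 0 * gp φ + max (min (-κ) 1) 0 * gm φ +
    (1 - max (min κ 1) 0 - max (min (-κ) 1) 0) * φ

section blend

variable {gm gp : ℝ → ℝ}

lemma blend_of_one_le {κ : ℝ} (h : 1 ≤ κ) (φ : ℝ) : blend gm gp κ φ = gp φ := by
  rw [blend, min_eq_right h, max_eq_left zero_le_one, min_eq_left (by linarith),
    max_eq_right (by linarith)]
  ring

lemma blend_of_le_neg_one {κ : ℝ} (h : κ ≤ -1) (φ : ℝ) : blend gm gp κ φ = gm φ := by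
  rw [blend, min_eq_left (by linarith), max_eq_right (by linarith), min_eq_right (by linarith),
    max_eq_left zero_le_one]
  ring

lemma blend_of_fixed {κ φ : ℝ} (h1 : gp φ = φ) (h2 : gm φ = φ) : blend gm gp κ φ = φ := by
  rw [blend, h1, h2]
  ring

lemma isCircleLift_blend (hm : IsCircleLift gm) (hp : IsCircleLift gp) (κ : ℝ) :
    IsCircleLift (blend gm gp κ) := by
  rcases le_total 0 κ with h | h
  · have h2 : max (min (-κ) 1) 0 = 0 := max_eq_right ((min_le_left _ _).trans (by linarith))
    have h3 : max (min κ 1) 0 = min κ 1 := max_eq_left (le_min h zero_le_one)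
    have := hp.convexComb IsCircleLift.id (le_min h zero_le_one)
      (sub_nonneg.2 (min_le_right κ 1)) (by ring)
    unfold blend
    simpa only [h2, h3, zero_mul, add_zero, sub_zero] using this
  · have h2 : max (min κ 1) 0 = 0 := max_eq_right ((min_le_left _ _).trans (by linarith))
    have h0 : 0 ≤ min (-κ) 1 := le_min (by linarith) zero_le_one
    have h3 : max (min (-κ) 1) 0 = min (-κ) 1 := max_eq_left h0
    have := hm.convexComb IsCircleLift.id h0 (sub_nonneg.2 (min_le_right (-κ) 1)) (by ring)
    unfold blend
    simpa only [h2, h3, zero_mul, zero_add, sub_zero] using this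

end blend

/-- Two neighbouring vertices `v` and `w` of an arc presentation can be exchanged if the edges at
`v` have their angles in the right half of the circle and the edges at `w` have theirs in the left
half. The vertices are first pushed off their circle, to where the second coordinate is `1/2` for
`v` and `-1/2` for `w`. In the disk of second coordinates, the edges at `v` are then over the right
half and the edges at `w` over the left half, and the angle of the first coordinate can be changed independently
there. The edge between `v` and `w` has angle `±π/2`, and its two halves are over different halves
of the disk; up to the point `±i` where they meet, `tilt` is at least `1` on the one and at most
`-1` on the other. -/
theorem arc_exchange {α α' : Fin n → ℝ} {ψ : Edge n → ℝ} {v w : Fin n}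
    (hα : Function.Injective fun a => cis (α a))
    {gm gp : ℝ → ℝ} (hgm : IsCircleLift gm) (hgp : IsCircleLift gp)
    (hv : cis (gp (α v)) = cis (α' v)) (hw : cis (gm (α w)) = cis (α' w))
    (hne : ∀ a, a ≠ v → a ≠ w → gp (α a) = α a ∧ gm (α a) = α a ∧ α' a = α a)
    (hvw : v ≠ w) (hα' : cis (α' v) = cis (α w)) (hα'' : cis (α' w) = cis (α v))
    (hvψ : ∀ e : Edge n, v ∈ (e : Sym2 (Fin n)) → 0 ≤ (cis (ψ e)).re)
    (hwψ : ∀ e : Edge n, w ∈ (e : Sym2 (Fin n)) → (cis (ψ e)).re ≤ 0) :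
    (arc α ψ).AmbientIsotopicVia 1 (arc α' ψ) := by
  classical
  -- the place in the disk to which a vertex is pushed
  let c : Fin n → ℂ := fun a => if a = v then 1 / 2 else if a = w then -(1 / 2) else 0
  have hcv : c v = 1 / 2 := if_pos rfl
  have hcw : c w = -(1 / 2) := by simp [c, hvw.symm]
  have hc : ∀ a, ‖c a‖ < 1 := fun a => by
    simp only [c]
    split_ifs <;> norm_num
  have hinj' : Function.Injective fun a => cis (α' a) := by
    have : (fun a => cis (α' a)) = fun a => cis (α (Equiv.swap v w a)) := by
      funext a
      by_cases h1 : a = v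
      · rw [h1, Equiv.swap_apply_left, hα']
      by_cases h2 : a = w
      · rw [h2, Equiv.swap_apply_right, hα'']
      rw [Equiv.swap_apply_of_ne_of_ne h1 h2, (hne a h1 h2).2.2]
    rw [this]
    exact hα.comp (Equiv.injective _)
  obtain ⟨m, hm1, hm⟩ := exists_continuous_norm_lt_one hα hc
  obtain ⟨m', hm1', hm'⟩ := exists_continuous_norm_lt_one hinj' hc
  obtain ⟨P, hP, hP0, hP1⟩ := exists_push_swap m hm1
  obtain ⟨P', hP', hP0', hP1'⟩ := exists_push_swap m' hm1'
  obtain ⟨T, hT, hT1, hT0⟩ := exists_twist_swap (fun y => blend gm gp (tilt y)) (by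
    have h1 : ContinuousOn (fun p : ℂ × ℝ => tilt p.1) (Metric.ball 0 1 ×ˢ univ) :=
      continuousOn_tilt.comp continuousOn_fst fun p hp => hp.1
    have h2 : Continuous fun p : ℂ × ℝ => gm p.2 := hgm.continuous.comp continuous_snd
    have h3 : Continuous fun p : ℂ × ℝ => gp p.2 := hgp.continuous.comp continuous_snd
    have h4 : ContinuousOn (fun p : ℂ × ℝ => max (min (tilt p.1) 1) 0)
        (Metric.ball 0 1 ×ˢ univ) := by
      have : Continuous fun t : ℝ => max (min t 1) 0 := by fun_prop
      exact this.comp_continuousOn h1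
    have h5 : ContinuousOn (fun p : ℂ × ℝ => max (min (-tilt p.1) 1) 0)
        (Metric.ball 0 1 ×ˢ univ) := by
      have : Continuous fun t : ℝ => max (min (-t) 1) 0 := by fun_prop
      exact this.comp_continuousOn h1
    exact ((h4.mul h3.continuousOn).add (h5.mul h2.continuousOn)).add
      (((continuousOn_const.sub h4).sub h5).mul continuousOn_snd)) fun y _ =>
        isCircleLift_blend hgm hgp _
  obtain ⟨Q, hQ, hQP, hPQ⟩ := hP'.symm
  -- over the points that a pushed vertex can reach, the rotation has the expected effect
  have hrot : ∀ a (e : Edge n), a ∈ (e : Sym2 (Fin n)) → ∀ y : ℂ, ‖y‖ < 1 →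
      y ∈ segment ℝ (c a) (cis (ψ e)) → cis (blend gm gp (tilt y) (α a)) = cis (α' a) := by
    intro a e ha y hy hseg
    by_cases h1 : a = v
    · subst h1
      rw [hcv] at hseg
      rw [blend_of_one_le (one_le_tilt (norm_cis _) (hvψ e ha) hy hseg), hv]
    by_cases h2 : a = w
    · subst h2
      rw [hcw] at hseg
      rw [blend_of_le_neg_one (tilt_le_neg_one (norm_cis _) (hwψ e ha) hy hseg), hw]
    obtain ⟨h3, h4, h5⟩ := hne a h1 h2
    rw [blend_of_fixed h3 h4, h5]
  -- one segment of an edge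
  have hpush : ∀ (F : S3 → S3) (μ : C(ℂ, ℂ)) (β : Fin n → ℝ),
      (∀ (x : S3) (u : ℂ), ‖u‖ = 1 → ((F x).1 0 = ‖(F x).1 0‖ * u ↔ x.1 0 = ‖x.1 0‖ * u)) →
      (∀ (x : S3) (u : ℂ), ‖u‖ = 1 → x.1 0 = ‖x.1 0‖ * u → (F x).1 1 = coneMap (μ u) (x.1 1)) →
      (∀ a, μ (cis (β a)) = c a) → ∀ (x : S3) a e,
      ((F x).1 0 = ‖(F x).1 0‖ * cis (β a) ∧ (F x).1 1 ∈ segment ℝ (c a) (cis (ψ e))) ↔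
        x.1 1 = ‖x.1 1‖ * cis (ψ e) ∧ x.1 0 = ‖x.1 0‖ * cis (β a) := by
    intro F μ β h0 h1 hμ x a e
    rw [h0 x _ (norm_cis _), and_comm]
    refine and_congr_left fun hx => ?_
    rw [h1 x _ (norm_cis _) hx, hμ, coneMap_mem_segment_iff (hc a) (norm_cis _)]
    exact and_iff_right (S3.norm_zero_le (S3.swap x))
  have htwist : ∀ (x : S3) a (e : Edge n), a ∈ (e : Sym2 (Fin n)) →
      (((T x).1 0 = ‖(T x).1 0‖ * cis (α' a) ∧ (T x).1 1 ∈ segment ℝ (c a) (cis (ψ e))) ↔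
        (x.1 0 = ‖x.1 0‖ * cis (α a) ∧ x.1 1 ∈ segment ℝ (c a) (cis (ψ e)))) := by
    intro x a e ha
    rw [hT1]
    refine and_congr_left fun hseg => ?_
    by_cases hx : x.1 0 = 0
    · have : (T x).1 0 = 0 := by
        rw [← norm_eq_zero, S3.norm_zero_eq_of_one_eq (congrArg _ (hT1 x)), hx, norm_zero]
      simp [hx, this]
    · have hlt : ‖x.1 1‖ < 1 := (S3.norm_zero_lt_iff (S3.swap x)).2 hx
      rw [← hrot a e ha _ hlt hseg]
      exact hT0 x (α a)
  have hseg : ∀ (x : S3) a (e : Edge n), a ∈ (e : Sym2 (Fin n)) →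
      (((Q (T (P x))).1 1 = ‖(Q (T (P x))).1 1‖ * cis (ψ e) ∧
          (Q (T (P x))).1 0 = ‖(Q (T (P x))).1 0‖ * cis (α' a)) ↔
        (x.1 1 = ‖x.1 1‖ * cis (ψ e) ∧ x.1 0 = ‖x.1 0‖ * cis (α a))) := by
    intro x a e ha
    rw [← hpush P' m' α' hP0' hP1' hm' (Q (T (P x))) a e, hPQ, htwist _ a e ha,
      hpush P m α hP0 hP1 hm]
  refine .of_isotopicToId ((hQ.comp hT).comp hP) (fun a => ?_) fun e x => ?_
  · set x := (arc α ψ).vertex a with hx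
    have hx0 : x.1 0 = cis (α a) := rfl
    have hx1 : x.1 1 = 0 := rfl
    let y : S3 := (arc α' ψ).vertex a
    have hy0 : y.1 0 = cis (α' a) := rfl
    have hy1 : y.1 1 = 0 := rfl
    have hPx := (hP0 x _ (norm_cis (α a))).2 (by simp [hx0])
    have hPx1 : (P x).1 1 = c a := by
      rw [hP1 x _ (norm_cis (α a)) (by simp [hx0]), hm, hx1]
      simp [coneMap]
    have hPy := (hP0' y _ (norm_cis (α' a))).2 (by simp [hy0])
    have hPy1 : (P' y).1 1 = c a := by
      rw [hP1' y _ (norm_cis (α' a)) (by simp [hy0]), hm', hy1]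
      simp [coneMap]
    obtain ⟨e, he⟩ : ∃ e : Edge n, a ∈ (e : Sym2 (Fin n)) := by
      by_cases hav : a = v
      · exact ⟨⟨s(a, w), by simpa [hav] using hvw⟩, by simp⟩
      · exact ⟨⟨s(a, v), by simpa using hav⟩, by simp⟩
    have hT := (htwist (P x) a e he).2 ⟨hPx, by rw [hPx1]; exact left_mem_segment _ _ _⟩
    have heq : T (P x) = P' y := by
      have h1 : (T (P x)).1 1 = (P' y).1 1 := by rw [hT1, hPx1, hPy1]
      refine S3.ext ?_ h1
      rw [hT.1, hPy, S3.norm_zero_eq_of_one_eq (congrArg _ h1)]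
    simp only [Function.comp_apply, heq, hQP, y, Equiv.Perm.coe_one, id_eq]
  · rw [edgePerm_one]
    simp only [arc, mem_ofPred_eq, Function.comp_apply]
    constructor
    · rintro ⟨h1, a, ha, h0⟩
      have := (hseg x a e ha).1 ⟨h1, h0⟩
      exact ⟨this.1, a, ha, this.2⟩
    · rintro ⟨h1, a, ha, h0⟩
      have := (hseg x a e ha).2 ⟨h1, h0⟩
      exact ⟨this.1, a, ha, this.2⟩

/-! ### Vertex permutations, crossings and cyclic orders -/

lemma crosses_of_cyclic {e f : Edge n} {p q r t : Fin n} (he : (e : Sym2 (Fin n)) = s(p, r))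
    (hf : (f : Sym2 (Fin n)) = s(q, t))
    (h : (p < q ∧ q < r ∧ r < t) ∨ (q < r ∧ r < t ∧ t < p) ∨ (r < t ∧ t < p ∧ p < q) ∨
      (t < p ∧ p < q ∧ q < r)) : Crosses e f := by
  rcases h with ⟨h1, h2, h3⟩ | ⟨h1, h2, h3⟩ | ⟨h1, h2, h3⟩ | ⟨h1, h2, h3⟩
  · exact ⟨p, q, r, t, h1, h2, h3, Or.inl ⟨he, hf⟩⟩
  · exact ⟨q, r, t, p, h1, h2, h3, Or.inr ⟨he.trans Sym2.eq_swap, hf⟩⟩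
  · exact ⟨r, t, p, q, h1, h2, h3, Or.inl ⟨he.trans Sym2.eq_swap, hf.trans Sym2.eq_swap⟩⟩
  · exact ⟨t, p, q, r, h1, h2, h3, Or.inr ⟨he, hf.trans Sym2.eq_swap⟩⟩

/-- To show that crossing is preserved by a permutation, only one of the two positions of the edges
has to be considered. -/
lemma crosses_edgePerm {σ : Equiv.Perm (Fin n)}
    (h : ∀ a b c d : Fin n, a < b → b < c → c < d → ∀ e f : Edge n,
      (e : Sym2 (Fin n)) = s(σ a, σ c) → (f : Sym2 (Fin n)) = s(σ b, σ d) → Crosses e f)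
    {e f : Edge n} (hef : Crosses e f) : Crosses (edgePerm σ e) (edgePerm σ f) := by
  obtain ⟨a, b, c, d, h1, h2, h3, ⟨he, hf⟩ | ⟨he, hf⟩⟩ := hef
  · exact h a b c d h1 h2 h3 _ _ (by rw [coe_edgePerm, he, Sym2.map_mk])
      (by rw [coe_edgePerm, hf, Sym2.map_mk])
  · exact (h a b c d h1 h2 h3 _ _ (by rw [coe_edgePerm, hf, Sym2.map_mk])
      (by rw [coe_edgePerm, he, Sym2.map_mk])).symm

lemma relabel_apply (σ : Equiv.Perm (Fin n)) (A : Edge n → Fin s) (e : Edge n) :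
    relabel σ A e = A (edgePerm σ⁻¹ e) := by
  rw [relabel, edgePerm_symm]

lemma relabel_one (A : Edge n → Fin s) : relabel 1 A = A := by
  funext e
  rw [relabel_apply, inv_one, edgePerm_one]

lemma relabel_mul (σ τ : Equiv.Perm (Fin n)) (A : Edge n → Fin s) :
    relabel (σ * τ) A = relabel σ (relabel τ A) := by
  funext e
  simp only [relabel_apply, mul_inv_rev, edgePerm_mul]

lemma IsBook.relabel {A : Edge n → Fin s} (hA : IsBook A) {σ : Equiv.Perm (Fin n)}
    (h : ∀ e f, Crosses e f → Crosses (edgePerm σ⁻¹ e) (edgePerm σ⁻¹ f)) :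
    IsBook (relabel σ A) := fun e f hef hc => by
  rw [relabel_apply, relabel_apply] at hef
  exact hA _ _ hef (h e f hc)

section rotation

lemma val_add_eq (a k : Fin n) :
    ((a : ℕ) + k < n ∧ ((a + k : Fin n) : ℕ) = a + k) ∨
      (n ≤ (a : ℕ) + k ∧ ((a + k : Fin n) : ℕ) + n = a + k) := by
  rw [Fin.val_add_eq_ite]
  have := a.2
  have := k.2
  split_ifs <;> omega

variable [NeZero n]

lemma val_sub_eq (c a : Fin n) :
    ((a : ℕ) ≤ c ∧ ((c - a : Fin n) : ℕ) + a = c) ∨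
      ((c : ℕ) < a ∧ ((c - a : Fin n) : ℕ) + a = c + n) := by
  have h := val_add_eq (c - a) a
  rw [sub_add_cancel] at h
  have := c.2
  have := (c - a).2
  omega

lemma crosses_addRight (k : Fin n) {e f : Edge n} (h : Crosses e f) :
    Crosses (edgePerm (Equiv.addRight k) e) (edgePerm (Equiv.addRight k) f) := by
  refine crosses_edgePerm (fun a b c d h1 h2 h3 e f he hf => crosses_of_cyclic he hf ?_) h
  simp only [Equiv.coe_addRight, Fin.lt_def] at h1 h2 h3 ⊢
  have := val_add_eq a k
  have := val_add_eq b k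
  have := val_add_eq c k
  have := val_add_eq d k
  have := d.2
  omega

lemma crosses_subLeft (k : Fin n) {e f : Edge n} (h : Crosses e f) :
    Crosses (edgePerm (Equiv.subLeft k) e) (edgePerm (Equiv.subLeft k) f) := by
  refine crosses_edgePerm (fun a b c d h1 h2 h3 e f he hf =>
    crosses_of_cyclic (he.trans Sym2.eq_swap) hf ?_) h
  simp only [Equiv.subLeft_apply, Fin.lt_def] at h1 h2 h3 ⊢
  have := val_sub_eq k a
  have := val_sub_eq k b
  have := val_sub_eq k c
  have := val_sub_eq k d
  have := d.2
  omega

lemma addRight_inv (k : Fin n) : (Equiv.addRight k : Equiv.Perm (Fin n))⁻¹ = Equiv.addRight (-k) := by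
  rw [inv_eq_iff_mul_eq_one]
  ext a
  simp

lemma subLeft_inv (k : Fin n) : (Equiv.subLeft k : Equiv.Perm (Fin n))⁻¹ = Equiv.subLeft k := by
  rw [inv_eq_iff_mul_eq_one]
  ext a
  simp

lemma IsBook.relabel_addRight {A : Edge n → Fin s} (hA : IsBook A) (k : Fin n) :
    IsBook (BookRepresentation.relabel (Equiv.addRight k) A) :=
  hA.relabel fun e f h => by
    rw [addRight_inv]
    exact crosses_addRight _ h

lemma IsBook.relabel_subLeft {A : Edge n → Fin s} (hA : IsBook A) (k : Fin n) :
    IsBook (BookRepresentation.relabel (Equiv.subLeft k) A) :=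
  hA.relabel fun e f h => by
    rw [subLeft_inv]
    exact crosses_subLeft _ h

end rotation

/-! ### Vertex angles of a layout -/

lemma SameCyclic.of_strictMono {x y : Fin n → ℝ} (hx : StrictMono x)
    (hx' : ∀ a b, x b < x a + 2 * Real.pi) (hy : StrictMono y)
    (hy' : ∀ a b, y b < y a + 2 * Real.pi) : SameCyclic x y :=
  SameCyclic.of_or fun a b hab => hab.lt_or_gt.imp
    (fun h => ⟨⟨hx h, hx' a b⟩, hy h, hy' a b⟩) fun h => ⟨⟨hx h, hx' b a⟩, hy h, hy' b a⟩

lemma SameCyclic.comp {ι κ : Type*} {x y : ι → ℝ} (h : SameCyclic x y) {f : κ → ι}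
    (hf : Function.Injective f) : SameCyclic (x ∘ f) (y ∘ f) :=
  fun _ _ hij => h _ _ (hf.ne hij)

namespace Layout

variable {s' : ℕ} (L : Layout n s) (L' : Layout n s')

lemma sameCyclic : SameCyclic L.vertexAngle L'.vertexAngle :=
  .of_strictMono L.vertexAngle_strictMono L.vertexAngle_lt L'.vertexAngle_strictMono
    L'.vertexAngle_lt

/-- Rotating the labels keeps the cyclic order: the angles of the labels that wrap around have to be
increased by `2π`. -/
lemma exists_sameCyclic_addRight (k : Fin n) :
    ∃ y, SameCyclic L.vertexAngle y ∧
      ∀ a, ∃ m : ℤ, y a = L'.vertexAngle (a + k) + 2 * Real.pi * m := by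
  classical
  let y : Fin n → ℝ := fun a =>
    if (a : ℕ) + k < n then L'.vertexAngle (a + k) else L'.vertexAngle (a + k) + 2 * Real.pi
  have hpi := Real.two_pi_pos
  have hmono : ∀ {a b : Fin n}, (a : ℕ) < b → L'.vertexAngle a < L'.vertexAngle b :=
    fun h => L'.vertexAngle_strictMono h
  have key : ∀ a b : Fin n, a < b → y a < y b ∧ y b < y a + 2 * Real.pi := by
    intro a b hab
    rw [Fin.lt_def] at hab
    have ha := val_add_eq a k
    have hb := val_add_eq b k
    have hb2 := b.2
    simp only [y]
    split_ifs with h1 h2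
    · exact ⟨hmono (by omega), L'.vertexAngle_lt _ _⟩
    · exact ⟨by linarith [L'.vertexAngle_lt (b + k) (a + k)],
        by linarith [hmono (a := b + k) (b := a + k) (by omega)]⟩
    · omega
    · exact ⟨by linarith [hmono (a := a + k) (b := b + k) (by omega)],
        by linarith [L'.vertexAngle_lt (a + k) (b + k)]⟩
  refine ⟨y, .of_strictMono L.vertexAngle_strictMono L.vertexAngle_lt
    (fun a b h => (key a b h).1) (fun a b => ?_), fun a => ?_⟩
  · rcases lt_trichotomy a b with h | rfl | h
    · exact (key a b h).2
    · linarith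
    · linarith [(key b a h).1]
  · simp only [y]
    split_ifs
    · exact ⟨0, by simp⟩
    · exact ⟨1, by simp⟩

/-- A reflection of the labels reverses the cyclic order. -/
lemma exists_sameCyclic_subLeft [NeZero n] (k : Fin n) :
    ∃ y, SameCyclic L.vertexAngle y ∧
      ∀ a, ∃ m : ℤ, y a = -L'.vertexAngle (k - a) + 2 * Real.pi * m := by
  classical
  let y : Fin n → ℝ := fun a =>
    if (a : ℕ) ≤ k then -L'.vertexAngle (k - a) else -L'.vertexAngle (k - a) + 2 * Real.pi
  have hpi := Real.two_pi_pos
  have hmono : ∀ {a b : Fin n}, (a : ℕ) < b → L'.vertexAngle a < L'.vertexAngle b :=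
    fun h => L'.vertexAngle_strictMono h
  have key : ∀ a b : Fin n, a < b → y a < y b ∧ y b < y a + 2 * Real.pi := by
    intro a b hab
    rw [Fin.lt_def] at hab
    have ha := val_sub_eq k a
    have hb := val_sub_eq k b
    have hb2 := b.2
    simp only [y]
    split_ifs with h1 h2
    · exact ⟨by linarith [hmono (a := k - b) (b := k - a) (by omega)],
        by linarith [L'.vertexAngle_lt (k - b) (k - a)]⟩
    · exact ⟨by linarith [L'.vertexAngle_lt (k - a) (k - b)],
        by linarith [hmono (a := k - a) (b := k - b) (by omega)]⟩
    · omega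
    · exact ⟨by linarith [hmono (a := k - b) (b := k - a) (by omega)],
        by linarith [L'.vertexAngle_lt (k - b) (k - a)]⟩
  refine ⟨y, .of_strictMono L.vertexAngle_strictMono L.vertexAngle_lt
    (fun a b h => (key a b h).1) (fun a b => ?_), fun a => ?_⟩
  · rcases lt_trichotomy a b with h | rfl | h
    · exact (key a b h).2
    · linarith
    · linarith [(key b a h).1]
  · simp only [y]
    split_ifs
    · exact ⟨0, by simp⟩
    · exact ⟨1, by simp⟩

end Layout

/-! ### Neighbouring vertices -/

/-- The labels `v ≠ w` differ by one modulo `n`. -/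
lemma adjacent_cases [NeZero n] {v w : Fin n} (hvw : v ≠ w) (h : w = v + 1 ∨ v = w + 1) :
    (w : ℕ) = v + 1 ∨ (v : ℕ) = w + 1 ∨ ((v : ℕ) + 1 = n ∧ (w : ℕ) = 0) ∨
      ((w : ℕ) + 1 = n ∧ (v : ℕ) = 0) := by
  have hne : (v : ℕ) ≠ w := fun h' => hvw (Fin.ext h')
  have hv := v.2
  have hw := w.2
  have h1 : ((1 : Fin n) : ℕ) = 1 := by
    rw [Fin.val_one', Nat.mod_eq_of_lt (by omega)]
  have h2 := val_add_eq v 1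
  have h3 := val_add_eq w 1
  rw [h1] at h2 h3
  rcases h with rfl | rfl <;> omega

lemma not_crosses_of_adjacent [NeZero n] {v w : Fin n} (hvw : v ≠ w) (h : w = v + 1 ∨ v = w + 1)
    {e f : Edge n} (he : (e : Sym2 (Fin n)) = s(v, w)) : ¬ Crosses e f := by
  rintro ⟨a, b, c, d, h1, h2, h3, h4⟩
  have hadj := adjacent_cases hvw h
  have hd := d.2
  rw [Fin.lt_def] at h1 h2 h3
  rcases h4 with ⟨h4, -⟩ | ⟨h4, -⟩ <;> rw [he, Sym2.eq_iff] at h4 <;>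
    rcases h4 with ⟨rfl, rfl⟩ | ⟨rfl, rfl⟩ <;> omega

/-- Exchanging two neighbouring vertices only affects the crossings of edges at one of them with
edges at the other. -/
lemma crosses_of_crosses_swap [NeZero n] {v w : Fin n} (hvw : v ≠ w) (h : w = v + 1 ∨ v = w + 1)
    {a b c d : Fin n} (h1 : a < b) (h2 : b < c) (h3 : c < d)
    (hn1 : ¬ ((w = a ∨ w = c) ∧ (v = b ∨ v = d))) (hn2 : ¬ ((v = a ∨ v = c) ∧ (w = b ∨ w = d)))
    {e f : Edge n} (he : (e : Sym2 (Fin n)) = s(Equiv.swap v w a, Equiv.swap v w c))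
    (hf : (f : Sym2 (Fin n)) = s(Equiv.swap v w b, Equiv.swap v w d)) : Crosses e f := by
  refine crosses_of_cyclic he hf ?_
  have hadj := adjacent_cases hvw h
  have hd := d.2
  have hsw : ∀ x : Fin n, (x = v ∧ Equiv.swap v w x = w) ∨ (x = w ∧ Equiv.swap v w x = v) ∨
      (x ≠ v ∧ x ≠ w ∧ Equiv.swap v w x = x) := by
    intro x
    by_cases hxv : x = v
    · exact Or.inl ⟨hxv, by rw [hxv, Equiv.swap_apply_left]⟩
    by_cases hxw : x = w
    · exact Or.inr (Or.inl ⟨hxw, by rw [hxw, Equiv.swap_apply_right]⟩)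
    · exact Or.inr (Or.inr ⟨hxv, hxw, Equiv.swap_apply_of_ne_of_ne hxv hxw⟩)
  simp only [Fin.ext_iff, Fin.lt_def, ne_eq] at *
  rcases hsw a with ha' | ha' | ha' <;> rcases hsw b with hb' | hb' | hb' <;>
    first
    | omega
    | (rcases hsw c with hc' | hc' | hc' <;> rcases hsw d with hd' | hd' | hd' <;> omega)

/-- The vertex `v` can be moved to its neighbour `w` if `w` is disregarded. -/
lemma Layout.exists_sameCyclic_exchange [NeZero n] (L : Layout n s) {v w : Fin n} (hvw : v ≠ w)
    (h : w = v + 1 ∨ v = w + 1) :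
    ∃ k : ℤ, SameCyclic (fun a : {a // a ≠ w} => L.vertexAngle a)
      fun a => if a = v then L.vertexAngle w + 2 * Real.pi * k else L.vertexAngle a := by
  have hmono : ∀ {a b : Fin n}, (a : ℕ) < b → L.vertexAngle a < L.vertexAngle b :=
    fun h => L.vertexAngle_strictMono h
  have hlt := L.vertexAngle_lt
  obtain ⟨k, hk⟩ : ∃ k : ℤ, ∀ b : Fin n, b ≠ v → b ≠ w →
      ((L.vertexAngle v < L.vertexAngle b ∧ L.vertexAngle b < L.vertexAngle v + 2 * Real.pi) ∧
        L.vertexAngle w + 2 * Real.pi * k < L.vertexAngle b ∧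
          L.vertexAngle b < L.vertexAngle w + 2 * Real.pi * k + 2 * Real.pi) ∨
      ((L.vertexAngle b < L.vertexAngle v ∧ L.vertexAngle v < L.vertexAngle b + 2 * Real.pi) ∧
        L.vertexAngle b < L.vertexAngle w + 2 * Real.pi * k ∧
          L.vertexAngle w + 2 * Real.pi * k < L.vertexAngle b + 2 * Real.pi) := by
    have hstep : (w : ℕ) = v + 1 ∨ (v : ℕ) = w + 1 → ∀ b : Fin n, b ≠ v → b ≠ w →
        ((v : ℕ) < b ∧ (w : ℕ) < b) ∨ ((b : ℕ) < v ∧ (b : ℕ) < w) := by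
      intro h b hb hb'
      have := Fin.val_ne_of_ne hb
      have := Fin.val_ne_of_ne hb'
      omega
    rcases or_assoc.2 (adjacent_cases hvw h) with h | ⟨hv, hw⟩ | ⟨hw, hv⟩
    · refine ⟨0, fun b hb hb' => ?_⟩
      simp only [Int.cast_zero, mul_zero, add_zero]
      rcases hstep h b hb hb' with ⟨h1, h2⟩ | ⟨h1, h2⟩
      · exact Or.inl ⟨⟨hmono h1, hlt _ _⟩, hmono h2, hlt _ _⟩
      · exact Or.inr ⟨⟨hmono h1, hlt _ _⟩, hmono h2, hlt _ _⟩
    · refine ⟨1, fun b hb hb' => Or.inr ?_⟩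
      have := Fin.val_ne_of_ne hb
      have := Fin.val_ne_of_ne hb'
      have h1 := hmono (a := b) (b := v) (by have := b.2; omega)
      have h2 := hmono (a := w) (b := b) (by omega)
      have h3 := hlt w b
      refine ⟨⟨h1, hlt _ _⟩, ?_, ?_⟩ <;> push_cast <;> linarith
    · refine ⟨-1, fun b hb hb' => Or.inl ?_⟩
      have := Fin.val_ne_of_ne hb
      have := Fin.val_ne_of_ne hb'
      have h1 := hmono (a := v) (b := b) (by omega)
      have h2 := hmono (a := b) (b := w) (by have := b.2; omega)
      have h3 := hlt b w
      refine ⟨⟨h1, hlt _ _⟩, ?_, ?_⟩ <;> push_cast <;> linarith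
  refine ⟨k, SameCyclic.of_or fun a b hab => ?_⟩
  have hab' : (a : Fin n) ≠ b := Subtype.coe_injective.ne hab
  by_cases ha : (a : Fin n) = v
  · have hb : (b : Fin n) ≠ v := fun h => hab' (ha.trans h.symm)
    simp only [if_pos ha, if_neg hb]
    rw [ha]
    exact hk b hb b.2
  by_cases hb : (b : Fin n) = v
  · simp only [if_pos hb, if_neg ha]
    rw [hb]
    exact (hk a ha a.2).symm
  · simp only [if_neg hb, if_neg ha]
    rcases hab'.lt_or_gt with h | h
    · exact Or.inl ⟨⟨hmono h, hlt _ _⟩, hmono h, hlt _ _⟩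
    · exact Or.inr ⟨⟨hmono h, hlt _ _⟩, hmono h, hlt _ _⟩

/-! ### Choice of edge angles -/

/-- The edge angles `ψ` are distinct on the circle, and they are in the order given by the sheets.
Contrary to `Compatible`, this does not depend on the position of the vertices. -/
def StronglyCompatible (A : Edge n → Fin s) (ψ : Edge n → ℝ) : Prop :=
  (Function.Injective fun e => cis (ψ e)) ∧
    ∀ e f, A e < A f → ψ e < ψ f ∧ ψ f < ψ e + 2 * Real.pi

lemma StronglyCompatible.compatible {A : Edge n → Fin s} {ψ : Edge n → ℝ}
    (h : StronglyCompatible A ψ) : Compatible A ψ :=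
  ⟨h.1, fun e f _ => h.2 e f⟩

lemma StronglyCompatible.relabel {A : Edge n → Fin s} {ψ : Edge n → ℝ}
    (h : StronglyCompatible A ψ) (σ : Equiv.Perm (Fin n)) :
    StronglyCompatible (relabel σ A) fun e => ψ (edgePerm σ⁻¹ e) :=
  ⟨h.1.comp (edgePerm σ⁻¹).injective, fun e f hef => h.2 _ _ (by
    simpa only [relabel_apply] using hef)⟩

/-- Distinct edge angles in the order of the sheets, such that the sheets before the threshold `t`
are over the left half and the other sheets over the right half of the circle. -/
lemma exists_angles (A : Edge n → Fin s) (t : ℕ) :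
    ∃ ψ : Edge n → ℝ, Function.Injective ψ ∧ (∀ e f, A e < A f → ψ e < ψ f) ∧
      (∀ e, -(3 * Real.pi / 2) < ψ e ∧ ψ e < Real.pi / 2) ∧
      (∀ e, (A e : ℕ) < t → ψ e < -(Real.pi / 2)) ∧
      ∀ e, t ≤ (A e : ℕ) → -(Real.pi / 2) < ψ e := by
  obtain ⟨N, ⟨i⟩⟩ := Finite.exists_equiv_fin (Edge n)
  -- the edges of a sheet are separated by fractions in the open unit interval
  let fr : Edge n → ℝ := fun e => ((i e : ℕ) + 1 : ℝ) / (N + 1)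
  have hfr0 : ∀ e, 0 < fr e := fun e => by positivity
  have hfr1 : ∀ e, fr e < 1 := fun e => by
    rw [div_lt_one (by positivity)]
    have : ((i e : ℕ) : ℝ) < N := by exact_mod_cast (i e).2
    linarith
  let x : Edge n → ℝ := fun e => (A e : ℕ) + fr e - t
  have hx : ∀ e f, A e < A f → x e < x f := fun e f h => by
    have : ((A e : ℕ) : ℝ) + 1 ≤ (A f : ℕ) := by exact_mod_cast h
    simp only [x]
    linarith [hfr0 f, hfr1 e]
  have hinj : Function.Injective x := by
    intro e f h
    rcases lt_trichotomy (A e) (A f) with h1 | h1 | h1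
    · exact absurd h (hx e f h1).ne
    · have h2 : fr e = fr f := by
        simp only [x, h1] at h
        linarith
      have h3 : ((i e : ℕ) : ℝ) = (i f : ℕ) := by
        have h4 : ((N : ℝ) + 1) ≠ 0 := by positivity
        simpa [fr, div_left_inj' h4] using h2
      exact i.injective (Fin.ext (by exact_mod_cast h3))
    · exact absurd h (hx f e h1).ne'
  refine ⟨fun e => -(Real.pi / 2) + 2 * Real.arctan (x e), fun e f h => hinj ?_,
    fun e f h => ?_, fun e => ?_, fun e h => ?_, fun e h => ?_⟩
  · apply Real.arctan_injective
    simpa using h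
  · linarith [Real.arctan_strictMono (hx e f h)]
  · constructor <;> linarith [Real.neg_pi_div_two_lt_arctan (x e), Real.arctan_lt_pi_div_two (x e)]
  · have h1 : ((A e : ℕ) : ℝ) + 1 ≤ t := by exact_mod_cast h
    have : x e < 0 := by
      simp only [x]
      linarith [hfr1 e]
    linarith [Real.arctan_lt_zero.2 this]
  · have h1 : (t : ℝ) ≤ (A e : ℕ) := by exact_mod_cast h
    have : 0 < x e := by
      simp only [x]
      linarith [hfr0 e]
    linarith [Real.arctan_pos.2 this]

lemma cis_injective_of_window {ψ : Edge n → ℝ} (h : Function.Injective ψ)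
    (hw : ∀ e f, ψ f < ψ e + 2 * Real.pi) : Function.Injective fun e => cis (ψ e) :=
  fun e f hef => h (eq_of_cis_eq hef (hw f e) (hw e f))

lemma exists_stronglyCompatible (A : Edge n → Fin s) : ∃ ψ, StronglyCompatible A ψ := by
  obtain ⟨ψ, hinj, hlt, hψ, -⟩ := exists_angles A 0
  have hw : ∀ e f, ψ f < ψ e + 2 * Real.pi := fun e f => by linarith [(hψ e).1, (hψ f).2]
  exact ⟨ψ, cis_injective_of_window hinj hw, fun e f h => ⟨hlt e f h, hw e f⟩⟩

/-! ### The moves -/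

lemma IsotopicVia.symm {s' : ℕ} {σ : Equiv.Perm (Fin n)} {A : Edge n → Fin s}
    {A' : Edge n → Fin s'} (h : IsotopicVia σ A A') : IsotopicVia σ⁻¹ A' A :=
  fun L L' => (h L' L).symm

/-- If the edges are at the same angles of the circle in compatible arc presentations of two book
representations, these book representations are isotopic. -/
theorem isotopicVia_one_of_cis_eq {s' : ℕ} {A : Edge n → Fin s} {A' : Edge n → Fin s'}
    (hA : IsBook A) (hA' : IsBook A') {ψ ψ' : Edge n → ℝ} (hψ : Compatible A ψ)
    (hψ' : Compatible A' ψ') (h : ∀ e, cis (ψ' e) = cis (ψ e)) : IsotopicVia 1 A A' :=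
  isotopicVia_of_arc hA hA' hψ hψ' fun L L' =>
    arc_ambientIsotopicVia (L.sameCyclic L').neg (fun _ => rfl) fun e => by rw [edgePerm_one, h]

theorem isotopicVia_one_refl {A : Edge n → Fin s} (hA : IsBook A) : IsotopicVia 1 A A := by
  obtain ⟨ψ, hψ⟩ := exists_stronglyCompatible A
  exact isotopicVia_one_of_cis_eq hA hA hψ.compatible hψ.compatible fun _ => rfl

theorem isotopicVia_addRight [NeZero n] {A : Edge n → Fin s} (hA : IsBook A) (k : Fin n) :
    IsotopicVia (Equiv.addRight k) A (relabel (Equiv.addRight k) A) := by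
  obtain ⟨ψ, hψ⟩ := exists_stronglyCompatible A
  refine isotopicVia_of_arc hA (hA.relabel_addRight k) hψ.compatible (hψ.relabel _).compatible
    fun L L' => ?_
  obtain ⟨y, hy, hyk⟩ := L.exists_sameCyclic_addRight L' k
  refine arc_ambientIsotopicVia hy.neg (fun a => ?_) fun e => ?_
  · obtain ⟨m, hm⟩ := hyk a
    rw [cis_eq_cis_iff]
    refine ⟨-m, ?_⟩
    rw [hm, Equiv.coe_addRight]
    push_cast
    ring
  · rw [← edgePerm_mul, inv_mul_cancel, edgePerm_one]

lemma cis_neg (φ : ℝ) : cis (-φ) = (starRingEnd ℂ) (cis φ) := by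
  rw [cis, cis, ← Complex.exp_conj]
  simp

lemma conj_eq_norm_mul_cis_iff {w : ℂ} {φ : ℝ} :
    (starRingEnd ℂ) w = ‖w‖ * cis (-φ) ↔ w = ‖w‖ * cis φ := by
  rw [cis_neg, ← (starRingEnd ℂ).injective.eq_iff, map_mul, Complex.conj_ofReal,
    Complex.conj_conj, Complex.conj_conj]

/-- The composition of a reflection in a diameter and the reflection in the plane preserves the
orientation, and it is realized by complex conjugation of both coordinates. -/
theorem arc_neg_ambientIsotopicVia (α : Fin n → ℝ) (ψ : Edge n → ℝ) :
    (arc α ψ).AmbientIsotopicVia 1 (arc (fun a => -α a) fun e => -ψ e) := by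
  obtain ⟨F, hF, h0, h1⟩ := exists_conj
  refine .of_isotopicToId hF (fun a => S3.ext ?_ ?_) fun e x => ?_
  · rw [h0]
    exact (cis_neg _).symm
  · rw [h1]
    exact map_zero _
  · rw [edgePerm_one]
    simp only [arc, Set.mem_ofPred_eq, h0, h1, RCLike.norm_conj, conj_eq_norm_mul_cis_iff]

theorem isotopicVia_subLeft_rev [NeZero n] {A : Edge n → Fin s} (hA : IsBook A) (k : Fin n) :
    IsBook (relabel (Equiv.subLeft k) fun e => (A e).rev) ∧
      IsotopicVia (Equiv.subLeft k) A (relabel (Equiv.subLeft k) fun e => (A e).rev) := by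
  obtain ⟨ψ, hψ⟩ := exists_stronglyCompatible A
  have hrev : IsBook fun e => (A e).rev := fun e f h => hA e f (Fin.rev_injective h)
  have hψ' : StronglyCompatible (fun e => (A e).rev) fun e => -ψ e := by
    refine ⟨fun e f h => hψ.1 ?_, fun e f h => ?_⟩
    · simp only [cis_neg] at h
      exact (starRingEnd ℂ).injective h
    · obtain ⟨h1, h2⟩ := hψ.2 f e (Fin.rev_lt_rev.1 h)
      constructor <;> linarith
  refine ⟨hrev.relabel_subLeft k, isotopicVia_of_arc hA (hrev.relabel_subLeft k) hψ.compatible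
    (hψ'.relabel _).compatible fun L L' => ?_⟩
  obtain ⟨y, hy, hyk⟩ := L.exists_sameCyclic_subLeft L' k
  have h1 := arc_neg_ambientIsotopicVia (fun a => -L.vertexAngle a) ψ
  simp only [neg_neg] at h1
  have h2 := h1.trans (arc_ambientIsotopicVia (σ := Equiv.subLeft k)
    (α' := fun a => -L'.vertexAngle a) (ψ' := fun e => -ψ (edgePerm (Equiv.subLeft k)⁻¹ e))
    hy (fun a => ?_) fun e => ?_)
  · simpa using h2
  · obtain ⟨m, hm⟩ := hyk a
    exact cis_eq_cis_iff.2 ⟨m, hm⟩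
  · rw [← edgePerm_mul, inv_mul_cancel, edgePerm_one]

theorem isotopicVia_reflections [NeZero n] {A : Edge n → Fin s} (hA : IsBook A)
    (r r' : Reflection n) :
    IsBook (r'.apply (r.apply A)) ∧
      IsotopicVia (r'.vertexPerm * r.vertexPerm) A (r'.apply (r.apply A)) := by
  rcases r with c | _ <;> rcases r' with c' | _
  · have h : (Equiv.subLeft c' : Equiv.Perm (Fin n)) * Equiv.subLeft c
        = Equiv.addRight (c' - c) := by
      apply Equiv.ext
      intro a
      simp only [Equiv.Perm.mul_apply, Equiv.subLeft_apply, Equiv.coe_addRight]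
      abel
    simp only [Reflection.apply, Reflection.vertexPerm, ← relabel_mul, h]
    exact ⟨hA.relabel_addRight _, isotopicVia_addRight hA _⟩
  · have := isotopicVia_subLeft_rev hA c
    simp only [Reflection.vertexPerm, one_mul]
    exact this
  · have := isotopicVia_subLeft_rev hA c'
    simp only [Reflection.vertexPerm, mul_one]
    exact this
  · simp only [Reflection.apply, Reflection.vertexPerm, Fin.rev_rev, mul_one]
    exact ⟨hA, isotopicVia_one_refl hA⟩

/-- The angles of the edges in the last sheet, which becomes the first one, are decreased by
`2π`. -/
theorem isotopicVia_finRotate {A : Edge n → Fin s} (hA : IsBook A) :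
    IsBook (fun e => finRotate s (A e)) ∧ IsotopicVia 1 A fun e => finRotate s (A e) := by
  have hA' : IsBook fun e => finRotate s (A e) := fun e f h => hA e f ((finRotate s).injective h)
  refine ⟨hA', ?_⟩
  rcases s with _ | s
  · have : (fun e => finRotate 0 (A e)) = A := funext fun e => (A e).elim0
    rw [this]
    exact isotopicVia_one_refl hA
  classical
  obtain ⟨ψ, hψ⟩ := exists_stronglyCompatible A
  let ψ' : Edge n → ℝ := fun e => if A e = Fin.last s then ψ e - 2 * Real.pi else ψ e
  have hcis : ∀ e, cis (ψ' e) = cis (ψ e) := fun e => by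
    simp only [ψ']
    split_ifs
    · exact cis_eq_cis_iff.2 ⟨-1, by push_cast; ring⟩
    · rfl
  refine isotopicVia_one_of_cis_eq hA hA' hψ.compatible ⟨?_, fun e f _ h => ?_⟩ hcis
  · simpa only [hcis] using hψ.1
  · rw [Fin.lt_def, coe_finRotate, coe_finRotate] at h
    simp only [ψ']
    split_ifs at h ⊢ with h1 h2 h2
    · omega
    · have := hψ.2 f e (h1 ▸ Fin.lt_last_iff_ne_last.2 h2)
      constructor <;> linarith
    · omega
    · exact hψ.2 e f (by rw [Fin.lt_def]; omega)

theorem isotopicVia_update {A : Edge n → Fin s} (hA : IsBook A) (e : Edge n) (j : Fin s)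
    (hadj : AdjacentSheets (A e) j) (hj : ∀ f, A f = j → ¬ Crosses e f) :
    IsBook (Function.update A e j) ∧ IsotopicVia 1 A (Function.update A e j) := by
  have hA' : IsBook (Function.update A e j) := by
    intro f g h hc
    rcases eq_or_ne f e with rfl | hf <;> rcases eq_or_ne g f with rfl | hg
    · exact hA _ _ rfl hc
    · rw [Function.update_self, Function.update_of_ne hg] at h
      exact hj g h.symm hc
    · exact hA _ _ rfl hc
    · rcases eq_or_ne g e with rfl | hg'
      · rw [Function.update_self, Function.update_of_ne hf] at h
        exact hj f h hc.symm
      · rw [Function.update_of_ne hf, Function.update_of_ne hg'] at h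
        exact hA f g h hc
  refine ⟨hA', ?_⟩
  obtain ⟨ψ, hψ⟩ := exists_stronglyCompatible A
  -- going from the last sheet to the first one or back changes the lift of the angle
  obtain ⟨k, hk⟩ : ∃ k : ℤ, ∀ f, A f ≠ A e → A f ≠ j →
      (j < A f → ψ e + 2 * Real.pi * k < ψ f ∧ ψ f < ψ e + 2 * Real.pi * k + 2 * Real.pi) ∧
      (A f < j → ψ f < ψ e + 2 * Real.pi * k ∧ ψ e + 2 * Real.pi * k < ψ f + 2 * Real.pi) := by
    rcases s with _ | s
    · exact (A e).elim0
    have hcases : (j : ℕ) = A e + 1 ∨ (A e : ℕ) = j + 1 ∨ ((A e : ℕ) = s ∧ (j : ℕ) = 0) ∨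
        ((A e : ℕ) = 0 ∧ (j : ℕ) = s) := by
      rcases hadj with h | h <;> rw [Fin.ext_iff, coe_finRotate] at h <;> split_ifs at h with h1
      · exact Or.inr (Or.inr (Or.inl ⟨by rw [h1]; simp, h.symm⟩))
      · exact Or.inl h.symm
      · exact Or.inr (Or.inr (Or.inr ⟨h.symm, by rw [h1]; simp⟩))
      · exact Or.inr (Or.inl h.symm)
    rcases or_assoc.2 hcases with h | ⟨h1, h2⟩ | ⟨h1, h2⟩
    · refine ⟨0, fun f hf hf' => ?_⟩
      have := Fin.val_ne_of_ne hf
      have := Fin.val_ne_of_ne hf'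
      simp only [Int.cast_zero, mul_zero, add_zero]
      exact ⟨fun h' => hψ.2 e f (by rw [Fin.lt_def] at h' ⊢; omega),
        fun h' => hψ.2 f e (by rw [Fin.lt_def] at h' ⊢; omega)⟩
    · refine ⟨-1, fun f hf hf' => ⟨fun _ => ?_, fun h' => ?_⟩⟩
      · have := hψ.2 f e (by
          have := Fin.val_ne_of_ne hf
          have := (A f).2
          rw [Fin.lt_def]; omega)
        constructor <;> push_cast <;> linarith
      · rw [Fin.lt_def] at h'
        omega
    · refine ⟨1, fun f hf hf' => ⟨fun h' => ?_, fun _ => ?_⟩⟩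
      · have := (A f).2
        rw [Fin.lt_def] at h'
        omega
      · have := hψ.2 e f (by
          have := Fin.val_ne_of_ne hf
          rw [Fin.lt_def]; omega)
        constructor <;> push_cast <;> linarith
  classical
  have hcis : ∀ f, cis (Function.update ψ e (ψ e + 2 * Real.pi * k) f) = cis (ψ f) := fun f => by
    rcases eq_or_ne f e with rfl | hf
    · rw [Function.update_self, cis_add_int_mul]
    · rw [Function.update_of_ne hf]
  have hcr : ∀ f, Crosses e f → A f ≠ A e ∧ A f ≠ j := fun f hf =>
    ⟨fun h => hA e f h.symm hf, fun h => hj f h hf⟩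
  refine isotopicVia_one_of_cis_eq hA hA' hψ.compatible
    (ψ' := Function.update ψ e (ψ e + 2 * Real.pi * k)) ⟨?_, fun f g hfg h => ?_⟩ hcis
  · simpa only [hcis] using hψ.1
  · rcases eq_or_ne f e with rfl | hf
    · rcases eq_or_ne g f with rfl | hg
      · exact absurd rfl (hcr _ hfg).1
      rw [Function.update_self, Function.update_of_ne hg] at h ⊢
      exact (hk g (hcr g hfg).1 (hcr g hfg).2).1 h
    · rcases eq_or_ne g e with rfl | hg
      · rw [Function.update_self, Function.update_of_ne hf] at h ⊢
        exact (hk f (hcr f hfg.symm).1 (hcr f hfg.symm).2).2 h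
      · rw [Function.update_of_ne hf, Function.update_of_ne hg] at h ⊢
        exact hψ.2 f g h

theorem isotopicVia_succAbove {A : Edge n → Fin s} (hA : IsBook A) (k : Fin (s + 1)) :
    IsBook (fun e => k.succAbove (A e)) ∧ IsotopicVia 1 A fun e => k.succAbove (A e) := by
  have hA' : IsBook fun e => k.succAbove (A e) := fun e f h =>
    hA e f (Fin.succAbove_right_injective h)
  obtain ⟨ψ, hψ⟩ := exists_stronglyCompatible A
  have hψ' : StronglyCompatible (fun e => k.succAbove (A e)) ψ :=
    ⟨hψ.1, fun e f h => hψ.2 e f ((Fin.strictMono_succAbove k).lt_iff_lt.1 h)⟩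
  exact ⟨hA', isotopicVia_one_of_cis_eq hA hA' hψ.compatible hψ'.compatible fun _ => rfl⟩

lemma succAbove_deleteSheet (A : Edge n → Fin (s + 1)) (k : Fin (s + 1)) (hk : ∀ e, A e ≠ k) :
    (fun e => k.succAbove (deleteSheet A k hk e)) = A := by
  funext e
  have := (finSuccAboveEquiv k).apply_symm_apply ⟨A e, hk e⟩
  exact congrArg Subtype.val this

theorem isotopicVia_deleteSheet {A : Edge n → Fin (s + 1)} (hA : IsBook A) (k : Fin (s + 1))
    (hk : ∀ e, A e ≠ k) :
    IsBook (deleteSheet A k hk) ∧ IsotopicVia 1 A (deleteSheet A k hk) := by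
  have hdel := succAbove_deleteSheet A k hk
  have hB : IsBook (deleteSheet A k hk) := fun e f h => hA e f (by
    rw [← congrFun hdel e, ← congrFun hdel f]
    exact congrArg _ h)
  refine ⟨hB, ?_⟩
  have := (isotopicVia_succAbove hB k).2.symm
  rwa [hdel, inv_one] at this

/-! ### Vertex exchange -/

/-- The vertex exchange move for arbitrary layouts of the two book representations, once the edges
at `v` have angles in the right half and the edges at `w` angles in the left half of the circle. -/
theorem arc_swap_ambientIsotopicVia [NeZero n] {s' : ℕ} (L : Layout n s) (L' : Layout n s')
    {v w : Fin n} (hvw : v ≠ w) (h : w = v + 1 ∨ v = w + 1) {ψ : Edge n → ℝ}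
    (hvψ : ∀ e : Edge n, v ∈ (e : Sym2 (Fin n)) → 0 ≤ (cis (ψ e)).re)
    (hwψ : ∀ e : Edge n, w ∈ (e : Sym2 (Fin n)) → (cis (ψ e)).re ≤ 0) :
    (arc (fun a => -L.vertexAngle a) ψ).AmbientIsotopicVia (Equiv.swap v w)
      (arc (fun a => -L'.vertexAngle a) fun e => ψ (edgePerm (Equiv.swap v w)⁻¹ e)) := by
  -- `g` moves `v` to the position of `w` and fixes the other vertices except possibly `w`
  have hlift : ∀ {v w : Fin n}, v ≠ w → (w = v + 1 ∨ v = w + 1) → ∃ g, IsCircleLift g ∧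
      cis (g (-L.vertexAngle v)) = cis (-L.vertexAngle w) ∧
      ∀ a, a ≠ v → a ≠ w → g (-L.vertexAngle a) = -L.vertexAngle a := by
    intro v w hvw h
    obtain ⟨k, hk⟩ := L.exists_sameCyclic_exchange hvw h
    obtain ⟨g, hg, hgα⟩ := hk.neg.exists_circleLift
    refine ⟨g, hg, ?_, fun a hav haw => ?_⟩
    · rw [cis_eq_cis_iff]
      refine ⟨-k, ?_⟩
      have := hgα ⟨v, hvw⟩
      simp only [if_true] at this
      rw [this]
      push_cast
      ring
    · have := hgα ⟨a, haw⟩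
      simpa only [if_neg hav] using this
  obtain ⟨gp, hgp, hgpv, hgpne⟩ := hlift hvw h
  obtain ⟨gm, hgm, hgmw, hgmne⟩ := hlift hvw.symm h.symm
  have hinj : Function.Injective fun a => cis (-L.vertexAngle a) := by
    have := L.position_injective
    rwa [funext L.position_eq_cis] at this
  have h1 := arc_exchange (α' := fun a => -L.vertexAngle (Equiv.swap v w a)) hinj hgm hgp
    (by rw [Equiv.swap_apply_left, hgpv]) (by rw [Equiv.swap_apply_right, hgmw])
    (fun a hav haw => ⟨hgpne a hav haw, hgmne a haw hav, by
      rw [Equiv.swap_apply_of_ne_of_ne hav haw]⟩) hvw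
    (by rw [Equiv.swap_apply_left]) (by rw [Equiv.swap_apply_right]) hvψ hwψ
  have h2 := h1.trans (arc_ambientIsotopicVia (σ := Equiv.swap v w)
    (α' := fun a => -L'.vertexAngle a) (ψ' := fun e => ψ (edgePerm (Equiv.swap v w)⁻¹ e))
    ((L.sameCyclic L').neg.comp (Equiv.swap v w).injective) (fun _ => rfl) fun e => by
      rw [← edgePerm_mul, inv_mul_cancel, edgePerm_one])
  simpa using h2

/-- The edges at `v`, being in the higher sheets, are put over the right half of the circle and the
edges at `w` over the left half. The edge between `v` and `w` does not cross any other edge, hence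
its angle can be chosen freely. -/
theorem isotopicVia_swap [NeZero n] {A : Edge n → Fin s} (hA : IsBook A) {v w : Fin n}
    (hvw : w = v + 1 ∨ v = w + 1)
    (h : ∀ e f : Edge n, v ∈ (e : Sym2 (Fin n)) → w ∈ (f : Sym2 (Fin n)) →
      (e : Sym2 (Fin n)) ≠ s(v, w) → (f : Sym2 (Fin n)) ≠ s(v, w) → A f < A e) :
    IsBook (relabel (Equiv.swap v w) A) ∧
      IsotopicVia (Equiv.swap v w) A (relabel (Equiv.swap v w) A) := by
  classical
  rcases eq_or_ne v w with rfl | hne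
  · have : (Equiv.swap v v : Equiv.Perm (Fin n)) = 1 := Equiv.swap_self v
    rw [this, relabel_one]
    exact ⟨hA, isotopicVia_one_refl hA⟩
  set σ : Equiv.Perm (Fin n) := Equiv.swap v w with hσ
  have hσinv : σ⁻¹ = σ := Equiv.swap_inv v w
  have hA' : IsBook (relabel σ A) := by
    -- two edges of the same sheet that are separated by `v` and `w` contradict the hypothesis
    have key : ∀ (a b c d : Fin n), a < b → b < c → c < d → ∀ e f : Edge n,
        (e : Sym2 (Fin n)) = s(σ a, σ c) → (f : Sym2 (Fin n)) = s(σ b, σ d) → A e = A f →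
        Crosses e f := by
      intro a b c d h1 h2 h3 e f he hf hef
      have hsep : ∀ p q r t : Fin n, p ≠ r → q ≠ r → p ≠ t → q ≠ t → ∀ e f : Edge n,
          (e : Sym2 (Fin n)) = s(σ p, σ q) → (f : Sym2 (Fin n)) = s(σ r, σ t) →
          A e = A f → ¬ ((w = p ∨ w = q) ∧ (v = r ∨ v = t)) := by
        rintro p q r t h1 h2 h3 h4 e f he hf hef ⟨hw, hv⟩
        have hve : v ∈ (e : Sym2 (Fin n)) := by
          rw [he]
          rcases hw with rfl | rfl <;> simp [hσ]
        have hwf : w ∈ (f : Sym2 (Fin n)) := by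
          rw [hf]
          rcases hv with rfl | rfl <;> simp [hσ]
        have hwe : w ∉ (e : Sym2 (Fin n)) := by
          rw [he, Sym2.mem_iff]
          rintro (h5 | h5) <;>
            have h6 := (Equiv.swap_apply_eq_iff.1 h5.symm).trans (Equiv.swap_apply_right v w) <;>
            subst h6 <;> rcases hv with hv | hv <;> contradiction
        have hvf : v ∉ (f : Sym2 (Fin n)) := by
          rw [hf, Sym2.mem_iff]
          rintro (h5 | h5) <;>
            have h6 := (Equiv.swap_apply_eq_iff.1 h5.symm).trans (Equiv.swap_apply_left v w) <;>
            subst h6 <;> rcases hw with hw | hw <;> simp_all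
        exact absurd hef (h e f hve hwf (fun h' => hwe (by rw [h']; simp))
          fun h' => hvf (by rw [h']; simp)).ne'
      refine crosses_of_crosses_swap hne hvw h1 h2 h3
        (hsep a c b d h1.ne h2.ne' (h1.trans (h2.trans h3)).ne h3.ne e f he hf hef)
        (fun h' => hsep b d a c h1.ne' (h1.trans (h2.trans h3)).ne' h2.ne h3.ne' f e hf he hef.symm
          h'.symm) he hf
    intro e f hef hc
    rw [relabel_apply, relabel_apply, hσinv] at hef
    have hc' : ∀ e f : Edge n, Crosses e f → A (edgePerm σ e) = A (edgePerm σ f) →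
        Crosses (edgePerm σ e) (edgePerm σ f) := by
      rintro e f ⟨a, b, c, d, h1, h2, h3, ⟨he, hf⟩ | ⟨he, hf⟩⟩ hef
      · exact key a b c d h1 h2 h3 _ _ (by rw [coe_edgePerm, he, Sym2.map_mk])
          (by rw [coe_edgePerm, hf, Sym2.map_mk]) hef
      · exact (key a b c d h1 h2 h3 _ _ (by rw [coe_edgePerm, hf, Sym2.map_mk])
          (by rw [coe_edgePerm, he, Sym2.map_mk]) hef.symm).symm
    exact hA _ _ hef (hc' e f hc hef)
  refine ⟨hA', ?_⟩
  let ε : Edge n := ⟨s(v, w), by simpa using hne⟩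
  have hε : ∀ {e : Edge n}, (e : Sym2 (Fin n)) = s(v, w) ↔ e = ε := fun {e} =>
    (Subtype.ext_iff (a1 := e) (a2 := ε)).symm
  have hεc : ∀ e, ¬ Crosses ε e := fun e => not_crosses_of_adjacent hne hvw rfl
  have hσε : edgePerm σ ε = ε := by
    apply Subtype.ext
    rw [coe_edgePerm]
    simp [ε, hσ, Sym2.eq_swap]
  -- the first sheet after all the sheets that contain edges at `w`
  have := Fintype.ofFinite (Edge n)
  let t : ℕ := (Finset.univ.filter fun f : Edge n => w ∈ (f : Sym2 (Fin n)) ∧ f ≠ ε).sup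
    fun f => (A f : ℕ) + 1
  have htw : ∀ f : Edge n, w ∈ (f : Sym2 (Fin n)) → f ≠ ε → (A f : ℕ) < t := fun f hf hf' =>
    Finset.le_sup (f := fun f : Edge n => (A f : ℕ) + 1) (by simp [hf, hf'])
  have htv : ∀ e : Edge n, v ∈ (e : Sym2 (Fin n)) → e ≠ ε → t ≤ (A e : ℕ) := fun e he he' => by
    refine Finset.sup_le fun f hf => ?_
    simp only [Finset.mem_filter, Finset.mem_univ, true_and] at hf
    exact h e f he hf.1 (mt hε.1 he') (mt hε.1 hf.2)
  obtain ⟨φ, hinj, hlt, hφ, hφt, htφ⟩ := exists_angles A t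
  let ψ : Edge n → ℝ := Function.update φ ε (-(Real.pi / 2))
  have hψε : ψ ε = -(Real.pi / 2) := Function.update_self ..
  have hψ : ∀ e, e ≠ ε → ψ e = φ e := fun e he => Function.update_of_ne he ..
  have hpi := Real.pi_pos
  have hφne : ∀ e, φ e ≠ -(Real.pi / 2) := fun e => by
    rcases lt_or_ge (A e : ℕ) t with h | h
    · exact (hφt e h).ne
    · exact (htφ e h).ne'
  have hwin : ∀ e, -(3 * Real.pi / 2) < ψ e ∧ ψ e < Real.pi / 2 := fun e => by
    by_cases he : e = ε
    · rw [he, hψε]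
      constructor <;> linarith
    · rw [hψ e he]
      exact hφ e
  have hinj' : Function.Injective ψ := by
    intro e f hef
    by_cases he : e = ε <;> by_cases hf : f = ε
    · rw [he, hf]
    · rw [he, hψε, hψ f hf] at hef
      exact absurd hef.symm (hφne f)
    · rw [hf, hψε, hψ e he] at hef
      exact absurd hef (hφne e)
    · rw [hψ e he, hψ f hf] at hef
      exact hinj hef
  have hw2 : ∀ e f, ψ f < ψ e + 2 * Real.pi := fun e f => by linarith [(hwin e).1, (hwin f).2]
  have hcis := cis_injective_of_window hinj' hw2
  have hord : ∀ e f, e ≠ ε → f ≠ ε → A e < A f → ψ e < ψ f ∧ ψ f < ψ e + 2 * Real.pi :=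
    fun e f he hf hef => ⟨by rw [hψ e he, hψ f hf]; exact hlt e f hef, hw2 e f⟩
  have hne1 : ∀ {e f}, Crosses e f → e ≠ ε := fun hc he => hεc _ (he ▸ hc)
  refine isotopicVia_of_arc hA hA' (ψ := ψ) (ψ' := fun e => ψ (edgePerm σ⁻¹ e))
    ⟨hcis, fun e f hc hef => hord e f (hne1 hc) (hne1 hc.symm) hef⟩
    ⟨hcis.comp (edgePerm σ⁻¹).injective, fun e f hc hef => ?_⟩
    fun L L' => arc_swap_ambientIsotopicVia L L' hne hvw (fun e he => ?_) fun e he => ?_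
  · have hne2 : ∀ {e}, e ≠ ε → edgePerm σ⁻¹ e ≠ ε := fun {e} he h' => he (by
      rw [hσinv] at h'
      rw [← hσε, ← h', ← edgePerm_mul, hσ, Equiv.swap_mul_self, edgePerm_one])
    rw [relabel_apply, relabel_apply] at hef
    exact hord _ _ (hne2 (hne1 hc)) (hne2 (hne1 hc.symm)) hef
  · rw [cis, Complex.exp_ofReal_mul_I_re]
    by_cases he' : e = ε
    · rw [he', hψε, Real.cos_neg, Real.cos_pi_div_two]
    · rw [hψ e he']
      exact (Real.cos_pos_of_mem_Ioo ⟨htφ e (htv e he he'), (hφ e).2⟩).le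
  · rw [cis, Complex.exp_ofReal_mul_I_re]
    by_cases he' : e = ε
    · rw [he', hψε, Real.cos_neg, Real.cos_pi_div_two]
    · rw [hψ e he', ← Real.cos_neg]
      exact Real.cos_nonpos_of_pi_div_two_le_of_le (by linarith [hφt e (htw e he he')])
        (by linarith [(hφ e).1])

end BookRepresentation

open BookRepresentation in
theorem mainTheorem1 (n : ℕ) [NeZero n] (s : ℕ) :
    -- rotating vertices
    (∀ A : Edge n → Fin s, IsBook A →
      (IsBook (relabel (Equiv.addRight 1) A) ∧
        IsotopicVia (Equiv.addRight 1) A (relabel (Equiv.addRight 1) A)) ∧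
      (IsBook (relabel (Equiv.subRight 1) A) ∧
        IsotopicVia (Equiv.subRight 1) A (relabel (Equiv.subRight 1) A))) ∧
    -- shifting sheets
    (∀ A : Edge n → Fin s, IsBook A →
      (IsBook (fun e => finRotate s (A e)) ∧
        IsotopicVia 1 A (fun e => finRotate s (A e))) ∧
      (IsBook (fun e => (finRotate s).symm (A e)) ∧
        IsotopicVia 1 A (fun e => (finRotate s).symm (A e)))) ∧
    -- edge move
    (∀ A : Edge n → Fin s, IsBook A → ∀ (e : Edge n) (j : Fin s),
      AdjacentSheets (A e) j → (∀ f, A f = j → ¬ Crosses e f) →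
      IsBook (Function.update A e j) ∧ IsotopicVia 1 A (Function.update A e j)) ∧
    -- vertex exchange
    (∀ A : Edge n → Fin s, IsBook A → ∀ v w : Fin n, (w = v + 1 ∨ v = w + 1) →
      (∀ e f : Edge n, v ∈ (e : Sym2 (Fin n)) → w ∈ (f : Sym2 (Fin n)) →
        (e : Sym2 (Fin n)) ≠ s(v, w) → (f : Sym2 (Fin n)) ≠ s(v, w) → A f < A e) →
      IsBook (relabel (Equiv.swap v w) A) ∧
        IsotopicVia (Equiv.swap v w) A (relabel (Equiv.swap v w) A)) ∧
    -- sheet insertion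
    (∀ A : Edge n → Fin s, IsBook A → ∀ k : Fin (s + 1),
      IsBook (fun e => k.succAbove (A e)) ∧
        IsotopicVia 1 A (fun e => k.succAbove (A e))) ∧
    -- sheet deletion
    (∀ A : Edge n → Fin (s + 1), IsBook A → ∀ (k : Fin (s + 1)) (hk : ∀ e, A e ≠ k),
      IsBook (deleteSheet A k hk) ∧ IsotopicVia 1 A (deleteSheet A k hk)) ∧
    -- double reflection
    (∀ A : Edge n → Fin s, IsBook A → ∀ r r' : Reflection n,
      IsBook (r'.apply (r.apply A)) ∧
        IsotopicVia (r'.vertexPerm * r.vertexPerm) A (r'.apply (r.apply A))) := by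
  refine ⟨fun A hA => ⟨⟨hA.relabel_addRight 1, isotopicVia_addRight hA 1⟩, ?_⟩,
    fun A hA => ⟨isotopicVia_finRotate hA, ?_⟩, fun A hA => isotopicVia_update hA,
    fun A hA v w => isotopicVia_swap hA, fun A hA => isotopicVia_succAbove hA,
    fun A hA => isotopicVia_deleteSheet hA, fun A hA => isotopicVia_reflections hA⟩
  · have h : (Equiv.subRight 1 : Equiv.Perm (Fin n)) = Equiv.addRight (-1) := by
      apply Equiv.ext
      intro a
      simp [sub_eq_add_neg]
    rw [h]
    exact ⟨hA.relabel_addRight _, isotopicVia_addRight hA _⟩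
  · have hB : IsBook fun e => (finRotate s).symm (A e) := fun e f h =>
      hA e f ((finRotate s).symm.injective h)
    refine ⟨hB, ?_⟩
    have := (isotopicVia_finRotate hB).2.symm
    simpa only [Equiv.apply_symm_apply, inv_one] using this
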